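/- **Theorem 1.5 (Equivariant Fellow Traveller Property).** Let $G$ be a group acting geometrically on two $\mathrm{CAT}(0)$ spaces $X$ and $Y$, and suppose that $X$ has isolated flats and the Relative Fellow Traveller Property. Then every $G$-equivariant quasi-isometry $f\colon X\to Y$ maps geodesics in $X$ uniformly close to geodesics in $Y$: there is a constant $L\ge 0$ (depending on $f$ and the actions, but not on the geodesic) such that for every geodesic $\alpha\colon I\to X$ there is a geodesic $\gamma\colon J\to Y$ for which the Hausdorff distance between $f(\alpha(I))$ and $\gamma(J)$ is at most $L$. Here the following terminology is used. * A *geodesic* in a metric space is an isometric embedding of an interval of $\mathbb R$, bounded or unbounded. A space is $\mathrm{CAT}(0)$ if any two of its points are joined by a geodesic and distances between points of any geodesic triangle are at most the distances between the corresponding points of a comparison triangle in the Euclidean plane. * An action is *geometric* if it is isometric, properly discontinuous, and cocompact. * For $\lambda\ge 1$ and $\epsilon\ge 0$, a (not necessarily continuous) map $f$ is a *$(\lambda,\epsilon)$-quasi-isometric embedding* if $\frac1\lambda d(a,b)-\epsilon\le d(f(a),f(b))\le\lambda\, d(a,b)+\epsilon$ for all $a,b$. It is a *quasi-isometry* if,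 for some $\lambda\ge 1$ and $\epsilon\ge 0$, it is a $(\lambda,\epsilon)$-quasi-isometric embedding and every point of the target is within $\epsilon$ of its image. A *$(\lambda,\epsilon)$-quasigeodesic* is a $(\lambda,\epsilon)$-quasi-isometric embedding of an interval. * A *flat* in $X$ is (the image of) an isometric embedding of a Euclidean space $\mathbb E^k$, $k\ge2$, into $X$. * $X$ has *isolated flats* if there is a family $\mathcal F$ of flats in $X$, invariant under all isometries of $X$, such that (i) for some constant $B$ every flat in $X$ lies in the $B$-neighborhood of some member of $\mathcal F$, and (ii) for some function $\psi\colon\mathbb R_+\to\mathbb R_+$, for all distinct $F_1,F_2\in\mathcal F$ and all $k\ge0$ the intersection of the $k$-neighborhoods of $F_1$ and $F_2$ has diameter at most $\psi(k)$. * Paths $\alpha\colon[0,a]\to X$ and $\alpha'\colon[0,a']\to X$ *$L$-fellow travel relative to flats* if there are $n\ge 0$, flats $F_1,\dots,F_n$ in $X$ and partitions $0=t_0\le s_0\le t_1\le s_1\le\dots\le t_n\le s_n=a$ and $0=t'_0\le s'_0\le t'_1\le s'_1\le\dots\le t'_n\le s'_n=a'$ such that for $0\le i\le n$ the Hausdorff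 distance between $\alpha([t_i,s_i])$ and $\alpha'([t'_i,s'_i])$ is at most $L$, and for $1\le i\le n$ the sets $\alpha([s_{i-1},t_i])$ and $\alpha'([s'_{i-1},t'_i])$ lie in the $L$-neighborhood of $F_i$. The space $X$ has the *Relative Fellow Traveller Property* (RFTP) if for all $\lambda\ge1$, $\epsilon\ge0$ there is a constant $L$ such that any two $(\lambda,\epsilon)$-quasigeodesics $[0,a]\to X$, $[0,a']\to X$ with common endpoints $L$-fellow travel relative to flats. -/

import Mathlib

open scoped NNReal ENNReal

namespace FellowTraveller

universe u v w

/-! ### Quasi-isometries and geodesics -/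

section Metric

variable {X : Type u} {Y : Type v} [MetricSpace X] [MetricSpace Y]

/-- `f` is a `(lam, eps)`-quasi-isometric embedding (no continuity is required). -/
def IsQIEmbedding (lam eps : ℝ) (f : X → Y) : Prop :=
  ∀ a b : X, lam⁻¹ * dist a b - eps ≤ dist (f a) (f b) ∧
    dist (f a) (f b) ≤ lam * dist a b + eps

/-- `f` is a quasi-isometry: for some constants `lam ≥ 1`, `eps ≥ 0` it is a
`(lam, eps)`-quasi-isometric embedding, and every point of `Y` is at distance at most `eps`
from the image of `f`. -/
def IsQuasiIsometry (f : X → Y) : Prop :=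
  ∃ lam eps : ℝ, 1 ≤ lam ∧ 0 ≤ eps ∧ IsQIEmbedding lam eps f ∧ ∀ y : Y, ∃ x : X, dist (f x) y ≤ eps

/-- The restriction of `c` to `I` is a geodesic: `I` is an interval of the real line (bounded or
not, so that segments, rays and lines are included) and `c` is an isometric embedding of `I`. The
values of `c` outside `I` play no role. -/
def IsGeodesic (I : Set ℝ) (c : ℝ → X) : Prop :=
  I.OrdConnected ∧ Isometry (I.domRestrict c)

/-- The restriction of `c` to `[0, dist x y]` is a geodesic segment from `x` to `y`. -/
def IsGeodesicSegment (x y : X) (c : ℝ → X) : Prop :=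
  IsGeodesic (Set.Icc 0 (dist x y)) c ∧ c 0 = x ∧ c (dist x y) = y

/-- The restriction of `c` to `[0, a]` is a `(lam, eps)`-quasigeodesic. -/
def IsQuasigeodesic (lam eps a : ℝ) (c : ℝ → X) : Prop :=
  IsQIEmbedding lam eps ((Set.Icc 0 a).domRestrict c)

end Metric

/-! ### CAT(0) spaces -/

/-- A `CAT(0)` space: a geodesic metric space all of whose geodesic triangles are at least as thin
as their comparison triangles in the Euclidean plane. In the second field, `c` and `c'` are two
sides of a geodesic triangle with vertices `p, q, r`, issuing from the vertex `p`; the points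
`p', q', r'` are the vertices of a comparison triangle, and `x'`, `y'` are the comparison points of
the points `c s`, `c' t` of these sides. As `p, q, r` are arbitrary, all pairs of sides are
covered (for two points on the same side the inequality is an equality). -/
structure IsCAT0 (X : Type u) [MetricSpace X] : Prop where
  geodesic : ∀ x y : X, ∃ c : ℝ → X, IsGeodesicSegment x y c
  thin : ∀ (p q r : X) (c c' : ℝ → X), IsGeodesicSegment p q c → IsGeodesicSegment p r c' →
    ∀ p' q' r' : EuclideanSpace ℝ (Fin 2),
      dist p' q' = dist p q → dist q' r' = dist q r → dist p' r' = dist p r →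
    ∀ s ∈ Set.Icc 0 (dist p q), ∀ t ∈ Set.Icc 0 (dist p r),
    ∀ x' ∈ segment ℝ p' q', ∀ y' ∈ segment ℝ p' r',
      dist p' x' = dist p (c s) → dist p' y' = dist p (c' t) →
      dist (c s) (c' t) ≤ dist x' y'

/-! ### Geometric actions -/

/-- The action of `G` on `X` is geometric: isometric, properly discontinuous and cocompact. -/
structure IsGeometricAction (G : Type w) (X : Type u) [Group G] [MetricSpace X]
    [MulAction G X] : Prop where
  isometric : IsIsometricSMul G X
  properlyDiscontinuous : ProperlyDiscontinuousSMul G X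
  cocompact : ∃ K : Set X, IsCompact K ∧ ⋃ g : G, (fun x : X => g • x) '' K = Set.univ

/-! ### Isolated flats -/

section Flats

variable {X : Type u} [MetricSpace X]

/-- `F` is a flat: the image of an isometric embedding of a Euclidean space of dimension `k ≥ 2`. -/
def IsFlat (F : Set X) : Prop :=
  ∃ k : ℕ, 2 ≤ k ∧ ∃ φ : EuclideanSpace ℝ (Fin k) → X, Isometry φ ∧ Set.range φ = F

variable (X) in
/-- `X` has isolated flats: there is a family `𝓕` of flats that is maximal, isolated and invariant
under all isometries of `X`. -/
def HasIsolatedFlats : Prop :=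
  ∃ 𝓕 : Set (Set X), (∀ F ∈ 𝓕, IsFlat F) ∧
    (∃ B : ℝ≥0, ∀ F : Set X, IsFlat F → ∃ F' ∈ 𝓕, F ⊆ Metric.cthickening B F') ∧
    (∃ ψ : ℝ≥0 → ℝ≥0, ∀ F₁ ∈ 𝓕, ∀ F₂ ∈ 𝓕, F₁ ≠ F₂ → ∀ k : ℝ≥0,
      Metric.ediam (Metric.cthickening k F₁ ∩ Metric.cthickening k F₂) ≤ ψ k) ∧
    (∀ e : X ≃ᵢ X, ∀ F ∈ 𝓕, e '' F ∈ 𝓕)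

end Flats

/-! ### The Relative Fellow Traveller Property -/

/-- `0 = t 0 ≤ s 0 ≤ t 1 ≤ s 1 ≤ ⋯ ≤ t n ≤ s n = a`. -/
structure IsPartition (n : ℕ) (a : ℝ) (t s : ℕ → ℝ) : Prop where
  left : t 0 = 0
  right : s n = a
  le : ∀ i ≤ n, t i ≤ s i
  le_next : ∀ i < n, s i ≤ t (i + 1)

section RFTP

variable {X : Type u} [MetricSpace X]

/-- The paths `α` on `[0, a]` and `α'` on `[0, a']` `L`-fellow travel relative to flats, namely
relative to the sequence of flats `F 0, …, F (n - 1)`. -/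
def FellowTravelRelFlats (L : ℝ≥0) (a a' : ℝ) (α α' : ℝ → X) : Prop :=
  ∃ (n : ℕ) (F : ℕ → Set X) (t s t' s' : ℕ → ℝ),
    (∀ i < n, IsFlat (F i)) ∧ IsPartition n a t s ∧ IsPartition n a' t' s' ∧
    (∀ i ≤ n, Metric.hausdorffEDist (α '' Set.Icc (t i) (s i)) (α' '' Set.Icc (t' i) (s' i)) ≤ L) ∧
    (∀ i < n, α '' Set.Icc (s i) (t (i + 1)) ⊆ Metric.cthickening L (F i) ∧
      α' '' Set.Icc (s' i) (t' (i + 1)) ⊆ Metric.cthickening L (F i))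

variable (X) in
/-- `X` has the Relative Fellow Traveller Property: quasigeodesics with common endpoints fellow
travel relative to flats, with a constant depending only on the quasigeodesic constants. -/
def HasRFTP : Prop :=
  ∀ lam eps : ℝ, 1 ≤ lam → 0 ≤ eps → ∃ L : ℝ≥0,
    ∀ (a a' : ℝ) (α α' : ℝ → X), 0 ≤ a → 0 ≤ a' →
      IsQuasigeodesic lam eps a α → IsQuasigeodesic lam eps a' α' →
      α 0 = α' 0 → α a = α' a' → FellowTravelRelFlats L a a' α α'

end RFTP

end FellowTraveller

/-! Let `α` be a geodesic segment in X, let `γ` be the geodesic in Y joining the endpoints of `f ∘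
α`, and lift `γ` through `f` to a quasigeodesic `β` in X. RFTP compares `α` with `β`. Where the two
are Hausdorff close, `f ∘ α` is close to `γ`. On the stretches near a flat only the ends of `α` are
controlled this way, so one needs to know that `f` sends geodesics near flats uniformly close to
geodesics of Y (`exists_near_flat_constant`); convexity of the metric of Y then compares these with
`γ` (`exists_segment_constant`).

For a flat: isolation makes the family of flats locally finite, so the stabilizer of each member
acts on it cocompactly, and Bieberbach's commutator argument
(`IsIsometricAffine.exists_translation_near`) yields a cocompact group T of translations. T is
finitely generated and has finite conjugacy classes, being abelian modulo the finite kernel of its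
action on the flat. Minimising a weighted sum of displacements in Y gives a point y such that `a •
y` is a midpoint of `y` and `a • a • y` for every `a` in T (`IsGeometricAction.exists_dist_sq_eq`).
By equivariance `f` on the flat is at bounded distance from the orbit map of y, so it almost
preserves midpoints, and repeated bisection (`IsCAT0.dist_lineMap_le`) makes it close to geodesics.
Finitely many orbits of flats give one constant.

Unbounded geodesics follow from segments by an ultrafilter limit (`exists_geodesic_of_segments`). -/

namespace FellowTraveller

universe u v w

/-! ### Convexity of the metric and uniqueness of geodesics in CAT(0) spaces. -/

section CATZero

variable {X : Type u} [MetricSpace X]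

/-- `c` restricted to `[0, 1]` is a geodesic parametrised proportionally to arc length. -/
def IsLinearGeodesic (c : ℝ → X) : Prop :=
  ∀ s ∈ Set.Icc (0 : ℝ) 1, ∀ t ∈ Set.Icc (0 : ℝ) 1,
    dist (c s) (c t) = |s - t| * dist (c 0) (c 1)

/-- The law of cosines gives the first coordinate `x` of the third vertex, and the triangle
inequalities put it in `[-b, b]`, so the second coordinate is a real square root. The formula
divides by `a`, hence the separate case `a = 0`. -/
lemma exists_comparison_triangle {a b c : ℝ} (ha : 0 ≤ a) (hb : 0 ≤ b) (hc : 0 ≤ c)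
    (h1 : a ≤ b + c) (h2 : b ≤ a + c) (h3 : c ≤ a + b) :
    ∃ p q r : EuclideanSpace ℝ (Fin 2), dist p q = a ∧ dist q r = c ∧ dist p r = b := by
  rcases eq_or_lt_of_le ha with ha0 | hapos
  · have hbc : b = c := by linarith
    refine ⟨0, 0, !₂[b, 0], by simp [ha0], ?_, ?_⟩ <;>
    · rw [EuclideanSpace.dist_eq]
      simp [Real.sqrt_sq_eq_abs, abs_of_nonneg hc, hbc]
  · set x : ℝ := (a ^ 2 + b ^ 2 - c ^ 2) / (2 * a) with hx
    have hxa : 2 * a * x = a ^ 2 + b ^ 2 - c ^ 2 := by rw [hx]; field_simp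
    have hx1 : x ≤ b := by
      have : 2 * a * x ≤ 2 * a * b := by
        rw [hxa]
        nlinarith [abs_le_of_sq_le_sq' (a := a - b) (b := c) (by nlinarith) hc]
      nlinarith
    have hx2 : -b ≤ x := by
      have : 2 * a * (-b) ≤ 2 * a * x := by rw [hxa]; nlinarith
      nlinarith
    have hy : 0 ≤ b ^ 2 - x ^ 2 := by nlinarith
    refine ⟨0, !₂[a, 0], !₂[x, Real.sqrt (b ^ 2 - x ^ 2)], ?_, ?_, ?_⟩
    · rw [EuclideanSpace.dist_eq]
      simp [Real.sqrt_sq_eq_abs, abs_of_nonneg ha]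
    · rw [EuclideanSpace.dist_eq]
      simp only [Fin.sum_univ_two, Real.dist_eq, sq_abs]
      simp only [Matrix.cons_val_zero, Matrix.cons_val_one, Matrix.cons_val_fin_one]
      rw [show (a - x) ^ 2 + (0 - Real.sqrt (b ^ 2 - x ^ 2)) ^ 2 = c ^ 2 by
        rw [zero_sub, neg_sq, Real.sq_sqrt hy]; nlinarith, Real.sqrt_sq hc]
    · rw [EuclideanSpace.dist_eq]
      simp only [Fin.sum_univ_two, Real.dist_eq, sq_abs]
      simp only [Matrix.cons_val_zero, Matrix.cons_val_one, Matrix.cons_val_fin_one, PiLp.zero_apply]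
      rw [show (0 - x) ^ 2 + (0 - Real.sqrt (b ^ 2 - x ^ 2)) ^ 2 = b ^ 2 by
        rw [zero_sub, neg_sq, zero_sub, neg_sq, Real.sq_sqrt hy]; ring, Real.sqrt_sq hb]

lemma IsLinearGeodesic.isGeodesicSegment {c : ℝ → X} (hc : IsLinearGeodesic c) :
    IsGeodesicSegment (c 0) (c 1) (fun s => c (s / dist (c 0) (c 1))) := by
  rcases eq_or_ne (dist (c 0) (c 1)) 0 with h0 | h0
  · refine ⟨⟨Set.ordConnected_Icc, ?_⟩, by simp, by simpa [h0] using dist_eq_zero.1 h0⟩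
    · apply Isometry.of_dist_eq
      rintro ⟨s, hs⟩ ⟨t, ht⟩
      rw [h0] at hs ht
      have hs : s = 0 := by simpa using hs
      have ht : t = 0 := by simpa using ht
      subst hs ht
      simp
  · have hpos : 0 < dist (c 0) (c 1) := lt_of_le_of_ne dist_nonneg (Ne.symm h0)
    refine ⟨⟨Set.ordConnected_Icc, ?_⟩, by simp, by simp [h0]⟩
    apply Isometry.of_dist_eq
    rintro ⟨s, hs⟩ ⟨t, ht⟩
    simp only [Set.domRestrict_apply]
    rw [hc _ ⟨div_nonneg hs.1 hpos.le, div_le_one_of_le₀ hs.2 hpos.le⟩ _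
      ⟨div_nonneg ht.1 hpos.le, div_le_one_of_le₀ ht.2 hpos.le⟩, ← sub_div, abs_div,
      abs_of_pos hpos, div_mul_cancel₀ _ h0, Subtype.dist_eq, Real.dist_eq]

lemma IsGeodesic.dist_eq {I : Set ℝ} {c : ℝ → X} (hc : IsGeodesic I c) {s t : ℝ} (hs : s ∈ I)
    (ht : t ∈ I) : dist (c s) (c t) = |s - t| := by
  have := hc.2.dist_eq ⟨s, hs⟩ ⟨t, ht⟩
  simpa [Subtype.dist_eq, Real.dist_eq] using this

lemma isGeodesic_of_dist_eq {I : Set ℝ} {c : ℝ → X} (hI : I.OrdConnected)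
    (h : ∀ s ∈ I, ∀ t ∈ I, dist (c s) (c t) = |s - t|) : IsGeodesic I c := by
  refine ⟨hI, Isometry.of_dist_eq ?_⟩
  rintro ⟨s, hs⟩ ⟨t, ht⟩
  simpa [Subtype.dist_eq, Real.dist_eq] using h s hs t ht

lemma IsGeodesic.isLinearGeodesic {I : Set ℝ} {c : ℝ → X} (hc : IsGeodesic I c) {a b : ℝ}
    (ha : a ∈ I) (hb : b ∈ I) : IsLinearGeodesic (fun θ => c (a + θ * (b - a))) := by
  have key : ∀ s ∈ Set.Icc (0 : ℝ) 1, a + s * (b - a) ∈ I := by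
    intro s hs
    convert hc.1.convex ha hb (sub_nonneg.2 hs.2) hs.1 (by ring) using 1
    simp only [smul_eq_mul]; ring
  intro s hs t ht
  simp only
  rw [hc.dist_eq (key s hs) (key t ht), hc.dist_eq (key 0 (by simp)) (key 1 (by simp)),
    ← abs_mul, ← abs_neg (_ * _)]
  ring_nf

lemma IsCAT0.exists_isLinearGeodesic (hX : IsCAT0 X) (x y : X) :
    ∃ c : ℝ → X, IsLinearGeodesic c ∧ c 0 = x ∧ c 1 = y := by
  obtain ⟨c, hc, h0, h1⟩ := hX.geodesic x y
  refine ⟨_, hc.isLinearGeodesic (a := 0) (b := dist x y) ?_ ?_, by simpa using h0,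
    by simpa using h1⟩ <;> simp

lemma IsLinearGeodesic.symm {c : ℝ → X} (hc : IsLinearGeodesic c) :
    IsLinearGeodesic (fun s => c (1 - s)) := by
  intro s hs t ht
  simp only
  rw [hc _ ⟨by linarith [hs.2], by linarith [hs.1]⟩ _ ⟨by linarith [ht.2], by linarith [ht.1]⟩,
    ← abs_neg]
  simp [dist_comm]

lemma IsLinearGeodesic.comp_affine {c : ℝ → X} (hc : IsLinearGeodesic c) {a b : ℝ}
    (ha : a ∈ Set.Icc (0 : ℝ) 1) (hb : b ∈ Set.Icc (0 : ℝ) 1) :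
    IsLinearGeodesic (fun θ => c (a + θ * (b - a))) := by
  have key : ∀ s ∈ Set.Icc (0 : ℝ) 1, a + s * (b - a) ∈ Set.Icc (0 : ℝ) 1 := by
    intro s hs
    convert convex_Icc (0 : ℝ) 1 ha hb (sub_nonneg.2 hs.2) hs.1 (by ring) using 1
    simp only [smul_eq_mul]; ring
  intro s hs t ht
  simp only
  rw [hc _ (key s hs) _ (key t ht), hc _ (key 0 (by simp)) _ (key 1 (by simp)), ← mul_assoc,
    ← abs_mul, ← abs_neg (_ * _)]
  ring_nf

lemma IsLinearGeodesic.comp_isometry {Y : Type v} [MetricSpace Y] {c : ℝ → X}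
    (hc : IsLinearGeodesic c) {e : X → Y} (he : Isometry e) : IsLinearGeodesic (fun s => e (c s)) := by
  intro s hs t ht
  simpa only [he.dist_eq] using hc s hs t ht

/-- Comparison points dividing two sides in the same ratio `θ` cut off a triangle similar to the
comparison triangle. -/
lemma IsCAT0.dist_le_of_start_eq (hX : IsCAT0 X) {c c' : ℝ → X} (hc : IsLinearGeodesic c)
    (hc' : IsLinearGeodesic c') (h0 : c 0 = c' 0) {θ : ℝ} (hθ : θ ∈ Set.Icc (0 : ℝ) 1) :
    dist (c θ) (c' θ) ≤ θ * dist (c 1) (c' 1) := by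
  have hs := hc.isGeodesicSegment
  have hs' := hc'.isGeodesicSegment
  rw [← h0] at hs'
  obtain ⟨p, q, r, hpq, hqr, hpr⟩ := exists_comparison_triangle (dist_nonneg (x := c 0) (y := c 1))
    (dist_nonneg (x := c 0) (y := c' 1)) (dist_nonneg (x := c 1) (y := c' 1))
    (by linarith [dist_triangle (c 0) (c' 1) (c 1), dist_comm (c' 1) (c 1)])
    (dist_triangle _ _ _) (by linarith [dist_triangle (c 1) (c 0) (c' 1), dist_comm (c 1) (c 0)])
  have hval : ∀ {c : ℝ → X}, IsLinearGeodesic c →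
      dist (c 0) (c (θ * dist (c 0) (c 1) / dist (c 0) (c 1))) = θ * dist (c 0) (c 1) ∧
      c (θ * dist (c 0) (c 1) / dist (c 0) (c 1)) = c θ := by
    intro c hc
    rcases eq_or_ne (dist (c 0) (c 1)) 0 with hd | hd
    · refine ⟨by simp [hd], ?_⟩
      have := hc 0 (by simp) θ hθ
      rw [hd, mul_zero] at this
      simpa [hd] using eq_of_dist_eq_zero this
    · rw [mul_div_cancel_right₀ _ hd, hc 0 (by simp) θ hθ]
      simp [abs_of_nonneg hθ.1]
  have hmem : ∀ d : ℝ, 0 ≤ d → θ * d ∈ Set.Icc 0 d := fun d hd =>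
    ⟨mul_nonneg hθ.1 hd, by nlinarith [hθ.2]⟩
  obtain ⟨hv1, hv2⟩ := hval hc
  obtain ⟨hv1', hv2'⟩ := hval hc'
  have key := hX.thin (c 0) (c 1) (c' 1) _ _ hs hs' p q r hpq hqr hpr
    (θ * dist (c 0) (c 1)) (hmem _ dist_nonneg) (θ * dist (c 0) (c' 1)) (hmem _ dist_nonneg)
    (AffineMap.lineMap p q θ) (by rw [segment_eq_image_lineMap]; exact ⟨θ, hθ, rfl⟩)
    (AffineMap.lineMap p r θ) (by rw [segment_eq_image_lineMap]; exact ⟨θ, hθ, rfl⟩)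
    (by rw [hv1, dist_left_lineMap, Real.norm_of_nonneg hθ.1, hpq])
    (by simp only [h0]; rw [hv1', dist_left_lineMap, Real.norm_of_nonneg hθ.1, hpr, h0])
  rw [hv2] at key
  simp only [h0] at key
  rw [hv2'] at key
  refine key.trans (le_of_eq ?_)
  rw [← hqr, dist_eq_norm, dist_eq_norm, AffineMap.lineMap_apply_module,
    AffineMap.lineMap_apply_module, add_sub_add_left_eq_sub, ← smul_sub, norm_smul,
    Real.norm_of_nonneg hθ.1]

/-- A diagonal cuts the quadrilateral into two triangles, each handled by
`IsCAT0.dist_le_of_start_eq`. -/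
lemma IsCAT0.dist_le (hX : IsCAT0 X) {c c' : ℝ → X} (hc : IsLinearGeodesic c)
    (hc' : IsLinearGeodesic c') {θ : ℝ} (hθ : θ ∈ Set.Icc (0 : ℝ) 1) :
    dist (c θ) (c' θ) ≤ (1 - θ) * dist (c 0) (c' 0) + θ * dist (c 1) (c' 1) := by
  obtain ⟨d, hd, hd0, hd1⟩ := hX.exists_isLinearGeodesic (c 0) (c' 1)
  have h1 := hX.dist_le_of_start_eq hc hd hd0.symm hθ
  have h2 := hX.dist_le_of_start_eq hd.symm hc'.symm (by simpa using hd1)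
    (θ := 1 - θ) ⟨by linarith [hθ.2], by linarith [hθ.1]⟩
  simp only [sub_sub_cancel, sub_self] at h2
  rw [hd1] at h1
  rw [hd0] at h2
  linarith [dist_triangle (c θ) (d θ) (c' θ)]

lemma IsCAT0.dist_le_of_le (hX : IsCAT0 X) {c c' : ℝ → X} (hc : IsLinearGeodesic c)
    (hc' : IsLinearGeodesic c') {C : ℝ} (h0 : dist (c 0) (c' 0) ≤ C) (h1 : dist (c 1) (c' 1) ≤ C)
    {θ : ℝ} (hθ : θ ∈ Set.Icc (0 : ℝ) 1) : dist (c θ) (c' θ) ≤ C := by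
  have := hX.dist_le hc hc' hθ
  nlinarith [hθ.1, hθ.2]

lemma IsCAT0.eq_of_endpoints_eq (hX : IsCAT0 X) {c c' : ℝ → X} (hc : IsLinearGeodesic c)
    (hc' : IsLinearGeodesic c') (h0 : c 0 = c' 0) (h1 : c 1 = c' 1)
    {θ : ℝ} (hθ : θ ∈ Set.Icc (0 : ℝ) 1) : c θ = c' θ :=
  dist_le_zero.1 (hX.dist_le_of_le hc hc' (by simp [h0]) (by simp [h1]) hθ)

/-- A point at half the distance from both endpoints is the midpoint of the geodesic. -/
lemma IsCAT0.eq_half (hX : IsCAT0 X) {c : ℝ → X} (hc : IsLinearGeodesic c) {m : X}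
    (h0 : dist (c 0) m = dist (c 0) (c 1) / 2) (h1 : dist m (c 1) = dist (c 0) (c 1) / 2) :
    c (1 / 2) = m := by
  classical
  obtain ⟨d, hd, hd0, hd1⟩ := hX.exists_isLinearGeodesic (c 0) m
  obtain ⟨e, he, he0, he1⟩ := hX.exists_isLinearGeodesic m (c 1)
  -- The concatenation through `m` has length equal to the distance of its endpoints, so it is a
  -- geodesic; uniqueness identifies it with `c`.
  set k : ℝ → X := fun s => if s ≤ 1 / 2 then d (2 * s) else e (2 * s - 1) with hk
  set l := dist (c 0) (c 1) with hl
  have k0 : k 0 = c 0 := by simp [hk, hd0]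
  have k1 : k 1 = c 1 := by
    have : ¬ ((1 : ℝ) ≤ 1 / 2) := by norm_num
    simp only [hk, if_neg this]; norm_num [he1]
  have kh : k (1 / 2) = m := by simp [hk, hd1]
  have hdk : ∀ s ∈ Set.Icc (0 : ℝ) (1 / 2), ∀ t ∈ Set.Icc (0 : ℝ) (1 / 2),
      dist (k s) (k t) = |s - t| * l := by
    intro s hs t ht
    simp only [hk, if_pos hs.2, if_pos ht.2]
    rw [hd _ ⟨by linarith [hs.1], by linarith [hs.2]⟩ _ ⟨by linarith [ht.1], by linarith [ht.2]⟩,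
      hd0, hd1, h0, ← mul_sub, abs_mul]
    norm_num; ring
  have hek : ∀ s ∈ Set.Icc (1 / 2 : ℝ) 1, ∀ t ∈ Set.Icc (1 / 2 : ℝ) 1,
      dist (k s) (k t) = |s - t| * l := by
    have aux : ∀ s ∈ Set.Icc (1 / 2 : ℝ) 1, k s = e (2 * s - 1) := by
      intro s hs
      by_cases h : s ≤ 1 / 2
      · have : s = 1 / 2 := le_antisymm h hs.1
        rw [this, kh]; norm_num [he0]
      · simp only [hk, if_neg h]
    intro s hs t ht
    rw [aux s hs, aux t ht,
      he _ ⟨by linarith [hs.1], by linarith [hs.2]⟩ _ ⟨by linarith [ht.1], by linarith [ht.2]⟩,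
      he0, he1, h1, show 2 * s - 1 - (2 * t - 1) = 2 * (s - t) by ring, abs_mul]
    norm_num; ring
  have hmix : ∀ s ∈ Set.Icc (0 : ℝ) (1 / 2), ∀ t ∈ Set.Icc (1 / 2 : ℝ) 1,
      dist (k s) (k t) = |s - t| * l := by
    intro s hs t ht
    have e1 := hdk s hs (1 / 2) (by constructor <;> norm_num)
    have e2 := hek (1 / 2) (by constructor <;> norm_num) t ht
    have e3 := hdk 0 (by constructor <;> norm_num) s hs
    have e4 := hek t ht 1 (by constructor <;> norm_num)
    have t1 := dist_triangle (k s) (k (1 / 2)) (k t)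
    have t2 := dist_triangle4 (k 0) (k s) (k t) (k 1)
    rw [abs_of_nonpos (by linarith [hs.2])] at e1
    rw [abs_of_nonpos (by linarith [ht.1])] at e2
    rw [abs_of_nonpos (by linarith [hs.1])] at e3
    rw [abs_of_nonpos (by linarith [ht.2])] at e4
    rw [abs_of_nonpos (by linarith [hs.2, ht.1])]
    rw [k0, k1] at t2
    rw [k0] at e3
    rw [k1] at e4
    nlinarith
  have hkl : IsLinearGeodesic k := by
    intro s hs t ht
    rw [k0, k1, ← hl]
    rcases le_total s (1 / 2) with h | h <;> rcases le_total t (1 / 2) with h' | h'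
    · exact hdk s ⟨hs.1, h⟩ t ⟨ht.1, h'⟩
    · exact hmix s ⟨hs.1, h⟩ t ⟨h', ht.2⟩
    · rw [dist_comm, abs_sub_comm]
      exact hmix t ⟨ht.1, h'⟩ s ⟨h, hs.2⟩
    · exact hek s ⟨h, hs.2⟩ t ⟨h', ht.2⟩
  rw [← kh]
  exact hX.eq_of_endpoints_eq hc hkl k0.symm k1.symm (by constructor <;> norm_num)

end CATZero

/-! ### Geometric actions on CAT(0) spaces: properness of the space. -/

lemma exists_smul_mem_of_iUnion_eq {G : Type w} {X : Type u} [SMul G X] {K : Set X}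
    (hK : ⋃ g : G, (fun x : X => g • x) '' K = Set.univ) (x : X) : ∃ g : G, ∃ k ∈ K, g • k = x := by
  have : x ∈ ⋃ g : G, (fun x : X => g • x) '' K := hK ▸ Set.mem_univ x
  simpa using this

section GeometricAction

variable {G : Type w} {X : Type u} [Group G] [MetricSpace X] [MulAction G X]

lemma IsGeometricAction.dist_smul (hG : IsGeometricAction G X) (g : G) (x y : X) :
    dist (g • x) (g • y) = dist x y :=
  (hG.isometric.isometry_smul g).dist_eq x y

lemma IsGeometricAction.dist_inv_smul (hG : IsGeometricAction G X) (g : G) (x y : X) :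
    dist (g⁻¹ • x) y = dist x (g • y) := by
  rw [← hG.dist_smul g, smul_inv_smul]

/-- Otherwise there are distinct `g n` and points `k n` of `K` with `g n • k n` tending to `v`.
Along a subsequence `k n`, hence also `(g n)⁻¹ • v`, converges to some `k₀`. The orbit points
together with `k₀` form a compact set met by infinitely many translates of `{v}`, against proper
discontinuity. -/
lemma IsGeometricAction.exists_finite_translates (hG : IsGeometricAction G X) {K : Set X}
    (hK : IsCompact K) (v : X) : ∃ ε > 0,
      {g : G | ((fun x : X => g • x) '' K ∩ Metric.closedBall v ε).Nonempty}.Finite := by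
  classical
  by_contra! hcon
  obtain ⟨f, hf1, hf2⟩ := exists_seq_of_forall_finset_exists
    (fun q : ℕ × G =>
      ((fun x : X => q.2 • x) '' K ∩ Metric.closedBall v (1 / ((q.1 : ℝ) + 1))).Nonempty)
    (fun p q => p.1 < q.1 ∧ p.2 ≠ q.2) (by
      intro s _
      set n := s.sup Prod.fst + 1
      have hinf : Set.Infinite _ := hcon (1 / ((n : ℝ) + 1)) (by positivity)
      obtain ⟨g, hg, hgs⟩ := hinf.exists_notMem_finset (s.image Prod.snd)
      refine ⟨(n, g), hg, fun x hx => ⟨Nat.lt_succ_of_le (Finset.le_sup (f := Prod.fst) hx), ?_⟩⟩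
      rintro rfl
      exact hgs (Finset.mem_image_of_mem _ hx))
  have hmono : StrictMono fun n => (f n).1 := fun m n h => (hf2 m n h).1
  have hinj : Function.Injective fun n => (f n).2 := by
    intro m n h
    by_contra hne
    rcases lt_or_gt_of_ne hne with h' | h'
    · exact (hf2 m n h').2 h
    · exact (hf2 n m h').2 h.symm
  have hk : ∀ n, ∃ k ∈ K, dist ((f n).2 • k) v ≤ 1 / (((f n).1 : ℝ) + 1) := by
    intro n
    obtain ⟨_, ⟨k, hk, rfl⟩, hb⟩ := hf1 n
    exact ⟨k, hk, hb⟩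
  choose k hkK hkd using hk
  obtain ⟨k₀, -, φ, hφ, hlim⟩ := hK.tendsto_subseq hkK
  have hw : Filter.Tendsto (fun n => (f (φ n)).2⁻¹ • v) Filter.atTop (nhds k₀) := by
    rw [tendsto_iff_dist_tendsto_zero] at hlim ⊢
    refine squeeze_zero (fun _ => dist_nonneg) (g := fun n =>
      1 / (((f (φ n)).1 : ℝ) + 1) + dist (k (φ n)) k₀) (fun n => ?_) ?_
    · refine (dist_triangle _ (k (φ n)) _).trans (add_le_add ?_ le_rfl)
      rw [hG.dist_inv_smul, dist_comm]
      exact hkd _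
    · rw [← add_zero (0 : ℝ)]
      refine Filter.Tendsto.add ?_ hlim
      exact tendsto_one_div_add_atTop_nhds_zero_nat.comp
        ((hmono.comp hφ).tendsto_atTop)
  have hfin := hG.properlyDiscontinuous.finite_disjoint_inter_image (isCompact_singleton (x := v))
    hw.isCompact_insert_range
  refine Set.infinite_of_injective_forall_mem (f := fun n => (f (φ n)).2⁻¹) ?_ ?_ hfin
  · intro m n h
    exact hφ.injective (hinj (inv_injective h))
  · intro n
    exact ⟨_, ⟨v, rfl, rfl⟩, Set.mem_insert_of_mem _ ⟨n, rfl⟩⟩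

/-- A small ball is covered by finitely many translates of the compact fundamental set. A Lebesgue
number makes the radius uniform there, and translation makes it uniform everywhere. -/
lemma IsGeometricAction.exists_isCompact_closedBall (hG : IsGeometricAction G X) :
    ∃ ε > 0, ∀ v : X, IsCompact (Metric.closedBall v ε) := by
  obtain ⟨K, hK, hcov⟩ := hG.cocompact
  have hc : ∀ g : G, Continuous fun x : X => g • x := fun g =>
    (hG.isometric.isometry_smul g).continuous
  have hloc : ∀ v : X, ∃ ε > 0, IsCompact (Metric.closedBall v ε) := by
    intro v
    obtain ⟨ε, hε, hfin⟩ := hG.exists_finite_translates hK v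
    refine ⟨ε, hε, (hfin.isCompact_biUnion fun g _ => hK.image (hc g)).of_isClosed_subset
      Metric.isClosed_closedBall fun x hx => ?_⟩
    obtain ⟨g, k, hk, rfl⟩ := exists_smul_mem_of_iUnion_eq hcov x
    exact Set.mem_biUnion (x := g) ⟨_, ⟨k, hk, rfl⟩, hx⟩ ⟨k, hk, rfl⟩
  choose ε hε hcomp using hloc
  obtain ⟨δ, hδ, hball⟩ := lebesgue_number_lemma_of_metric hK (c := fun v => Metric.ball v (ε v))
    (fun _ => Metric.isOpen_ball)
    (fun x _ => Set.mem_iUnion.2 ⟨x, Metric.mem_ball_self (hε x)⟩)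
  refine ⟨δ / 2, half_pos hδ, fun v => ?_⟩
  obtain ⟨g, k, hk, rfl⟩ := exists_smul_mem_of_iUnion_eq hcov v
  obtain ⟨i, hi⟩ := hball k hk
  have : IsCompact (Metric.closedBall k (δ / 2)) :=
    (hcomp i).of_isClosed_subset Metric.isClosed_closedBall
      ((Metric.closedBall_subset_ball (half_lt_self hδ)).trans
        (hi.trans Metric.ball_subset_closedBall))
  refine (this.image (hc g)).of_isClosed_subset Metric.isClosed_closedBall fun x hx => ?_
  refine ⟨g⁻¹ • x, ?_, smul_inv_smul g x⟩
  rw [Metric.mem_closedBall, hG.dist_inv_smul]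
  exact hx

/-- Radii grow in steps of `ε / 2`: moving back along a geodesic brings a point of the larger ball
within `ε / 2` of the smaller one, hence within `ε` of a finite `ε / 2`-net, whose closed `ε`-balls
are compact. -/
lemma IsGeometricAction.properSpace (hG : IsGeometricAction G X) (hX : IsCAT0 X) :
    ProperSpace X := by
  obtain ⟨ε, hε, hcomp⟩ := hG.exists_isCompact_closedBall
  have key : ∀ (n : ℕ) (x : X), IsCompact (Metric.closedBall x (n * (ε / 2))) := by
    intro n x
    induction n with
    | zero => simp
    | succ n ih =>
      obtain ⟨t, htf, ht⟩ := Metric.totallyBounded_iff.1 ih.totallyBounded (ε / 2) (half_pos hε)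
      refine (htf.isCompact_biUnion fun z _ => hcomp z).of_isClosed_subset
        Metric.isClosed_closedBall fun y hy => ?_
      rw [Metric.mem_closedBall, dist_comm] at hy
      push_cast at hy
      obtain ⟨c, hc, h0, h1⟩ := hX.geodesic x y
      set s := min (dist x y) (n * (ε / 2)) with hs
      have hs0 : 0 ≤ s := le_min dist_nonneg (by positivity)
      have hmem : s ∈ Set.Icc 0 (dist x y) := ⟨hs0, min_le_left _ _⟩
      have hxs : dist x (c s) = s := by
        conv_lhs => rw [← h0]
        rw [hc.dist_eq ⟨le_rfl, dist_nonneg⟩ hmem, zero_sub, abs_neg, abs_of_nonneg hs0]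
      have hsy : dist (c s) y ≤ ε / 2 := by
        conv_lhs => rw [← h1]
        rw [hc.dist_eq hmem ⟨dist_nonneg, le_rfl⟩, abs_of_nonpos (by linarith [hmem.2])]
        rcases min_cases (dist x y) (n * (ε / 2)) with h | h <;> rw [← hs] at h <;> linarith
      have : c s ∈ Metric.closedBall x (n * (ε / 2)) := by
        rw [Metric.mem_closedBall, dist_comm, hxs]
        exact min_le_right _ _
      obtain ⟨z, hz, hzc⟩ := Set.mem_iUnion₂.1 (ht this)
      refine Set.mem_biUnion hz ?_
      rw [Metric.mem_ball] at hzc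
      rw [Metric.mem_closedBall]
      linarith [dist_triangle y (c s) z, dist_comm y (c s)]
  refine ⟨fun x r => ?_⟩
  obtain ⟨n, hn⟩ := exists_nat_ge (r / (ε / 2))
  refine (key n x).of_isClosed_subset Metric.isClosed_closedBall
    (Metric.closedBall_subset_closedBall ?_)
  rwa [div_le_iff₀ (half_pos hε)] at hn

lemma IsGeometricAction.finite_setOf_dist_le (hG : IsGeometricAction G X) [ProperSpace X]
    (x y : X) (r : ℝ) : {g : G | dist (g • x) y ≤ r}.Finite := by
  refine (hG.properlyDiscontinuous.finite_disjoint_inter_image (isCompact_singleton (x := x))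
    (isCompact_closedBall y r)).subset fun g hg => ?_
  exact ⟨g • x, ⟨x, rfl, rfl⟩, hg⟩

end GeometricAction

/-! ### Bieberbach's theorem: translations in discrete cocompact groups of affine isometries. -/

section Bieberbach

/-- With `Z = D ^ 2 ^ m - 1`, squaring gives `2 Z + Z * Z`, so while `‖Z‖ ≤ 1 / 2` each squaring
increases the distance to 1 by a factor of at least `3 / 2`. -/
lemma eq_one_of_norm_pow_sub_one_le {R : Type*} [NormedRing R] [NormedAlgebra ℝ R] {D : R}
    (h : ∀ n : ℕ, ‖D ^ n - 1‖ ≤ 1 / 2) : D = 1 := by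
  have step : ∀ m : ℕ, (3 / 2 : ℝ) ^ m * ‖D - 1‖ ≤ ‖D ^ 2 ^ m - 1‖ := by
    intro m
    induction m with
    | zero => simp
    | succ m ih =>
      set Z := D ^ 2 ^ m - 1 with hZ
      have e : (2 : ℝ) • Z = (D ^ 2 ^ (m + 1) - 1) - Z * Z := by
        have : D ^ 2 ^ (m + 1) = D ^ 2 ^ m * D ^ 2 ^ m := by rw [pow_succ, mul_two, pow_add]
        rw [this, hZ, two_smul]; noncomm_ring
      have h1 : 2 * ‖Z‖ ≤ ‖D ^ 2 ^ (m + 1) - 1‖ + ‖Z‖ * ‖Z‖ := by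
        rw [← Real.norm_of_nonneg (zero_le_two (α := ℝ)), ← norm_smul, e]
        exact (norm_sub_le _ _).trans (by gcongr; exact norm_mul_le _ _)
      have h3 : ‖Z‖ ≤ 1 / 2 := h _
      rw [pow_succ]
      nlinarith [norm_nonneg Z]
  by_contra hne
  have hpos : 0 < ‖D - 1‖ := norm_pos_iff.2 (sub_ne_zero.2 hne)
  obtain ⟨m, hm⟩ := pow_unbounded_of_one_lt (1 / ‖D - 1‖) (by norm_num : (1 : ℝ) < 3 / 2)
  rw [div_lt_iff₀ hpos] at hm
  linarith [step m, h (2 ^ m)]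

lemma commutator_pow_of_commute {Γ : Type*} [Group Γ] {g h : Γ}
    (hc : Commute g (g * h * g⁻¹ * h⁻¹)) (n : ℕ) :
    (g * h * g⁻¹ * h⁻¹) ^ n = g ^ n * h * (g ^ n)⁻¹ * h⁻¹ := by
  set D := g * h * g⁻¹ * h⁻¹ with hD
  induction n with
  | zero => simp
  | succ n ih =>
    have e : g ^ n * h * (g ^ n)⁻¹ = D ^ n * h := by rw [ih]; group
    have e2 : g * h * g⁻¹ = D * h := by rw [hD]; group
    have e3 : g * D ^ n = D ^ n * g := hc.pow_right n
    calc D ^ (n + 1) = D ^ n * (D * h) * h⁻¹ := by rw [pow_succ]; group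
      _ = (D ^ n * g) * h * g⁻¹ * h⁻¹ := by rw [← e2]; group
      _ = g * (D ^ n * h) * g⁻¹ * h⁻¹ := by rw [← e3]; group
      _ = _ := by rw [← e, pow_succ']; group

variable {E : Type*} [NormedAddCommGroup E] [NormedSpace ℝ E]

/-- If `u = (L - 1) w` is fixed by `L`, then the `n`-th iterate of `L` sends `w` to `w + n • u`;
constant norm forces `u = 0`. -/
lemma map_eq_self_of_iterate {L : E →L[ℝ] E} (hL : ∀ x, ‖L x‖ = ‖x‖) {w : E}
    (h : (L - 1) ((L - 1) w) = 0) : (L - 1) w = 0 := by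
  set u := (L - 1) w with hu
  have hLu : L u = u := by simpa [sub_eq_zero] using h
  have hLw : L w = w + u := by rw [hu]; simp
  have hit : ∀ n : ℕ, ‖w + n • u‖ = ‖w‖ := by
    intro n
    induction n with
    | zero => simp
    | succ n ih =>
      rw [← ih, ← hL (w + n • u), map_add, map_nsmul, hLu, hLw, succ_nsmul']
      congr 1; abel
  by_contra hne
  obtain ⟨n, hn⟩ := exists_nat_gt (2 * ‖w‖ / ‖u‖)
  rw [div_lt_iff₀ (norm_pos_iff.2 hne)] at hn
  have h1 : ‖n • u‖ = n * ‖u‖ := by rw [← Nat.cast_smul_eq_nsmul ℝ, norm_smul]; simp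
  have h2 : ‖n • u‖ ≤ ‖w + n • u‖ + ‖w‖ := by
    have := norm_sub_le (w + n • u) w
    simpa using this
  rw [hit] at h2
  linarith

variable {H : Type*} [Group H]

/-- The elements `h` act on `E` by the isometries `x ↦ A h x + b h`. -/
structure IsIsometricAffine (A : H →* (E →L[ℝ] E)) (b : H → E) : Prop where
  norm_map : ∀ h x, ‖A h x‖ = ‖x‖
  map_mul : ∀ g h, b (g * h) = A g (b h) + b g

namespace IsIsometricAffine

variable {A : H →* (E →L[ℝ] E)} {b : H → E} (hA : IsIsometricAffine A b)
include hA

lemma norm_le_one (h : H) : ‖A h‖ ≤ 1 :=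
  ContinuousLinearMap.opNorm_le_bound _ zero_le_one fun x => by rw [hA.norm_map, one_mul]

lemma norm_mul_le_left (h : H) (B : E →L[ℝ] E) : ‖A h * B‖ ≤ ‖B‖ :=
  (norm_mul_le _ _).trans (mul_le_of_le_one_left (norm_nonneg _) (hA.norm_le_one h))

lemma norm_mul_le_right (h : H) (B : E →L[ℝ] E) : ‖B * A h‖ ≤ ‖B‖ :=
  (norm_mul_le _ _).trans (mul_le_of_le_one_right (norm_nonneg _) (hA.norm_le_one h))

/-- By commutation the powers of the commutator are the commutators of `g ^ n` with `h`, which stay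
within `2 * ‖A h - 1‖ ≤ 1 / 2` of the identity for all `n`. -/
lemma commutator_linear_eq_one {g h : H} (hh : ‖A h - 1‖ ≤ 1 / 4)
    (hc : Commute (A g) (A (g * h * g⁻¹ * h⁻¹))) : A (g * h * g⁻¹ * h⁻¹) = 1 := by
  refine eq_one_of_norm_pow_sub_one_le fun n => ?_
  have hpow : A (g * h * g⁻¹ * h⁻¹) ^ n = A (g ^ n * h * (g ^ n)⁻¹ * h⁻¹) := by
    have hu : Commute (A.toHomUnits g)
        (A.toHomUnits g * A.toHomUnits h * (A.toHomUnits g)⁻¹ * (A.toHomUnits h)⁻¹) := by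
      simp only [← map_inv, ← _root_.map_mul]
      exact Units.ext hc
    have := commutator_pow_of_commute hu n
    simp only [← map_inv, ← _root_.map_mul, ← map_pow] at this
    rw [← map_pow]
    exact congrArg Units.val this
  have e : A (g ^ n * h * (g ^ n)⁻¹ * h⁻¹) - 1 =
      (A (g ^ n) * (A h - 1) * A (g ^ n)⁻¹ - (A h - 1)) * A h⁻¹ := by
    have e1 : A (g ^ n) * A (g ^ n)⁻¹ = 1 := by rw [← _root_.map_mul]; simp
    have e2 : A h * A h⁻¹ = 1 := by rw [← _root_.map_mul]; simp
    rw [mul_sub, mul_one, sub_mul (A (g ^ n) * A h), e1, sub_sub_sub_cancel_right, sub_mul, e2]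
    simp only [_root_.map_mul]
  rw [hpow, e]
  refine (hA.norm_mul_le_right _ _).trans ((norm_sub_le _ _).trans ?_)
  have := (hA.norm_mul_le_right (g ^ n)⁻¹ (A (g ^ n) * (A h - 1))).trans
    (hA.norm_mul_le_left (g ^ n) (A h - 1))
  linarith

/-- Obtained by evaluating `b` on both sides of `[g, x] * (x * g) = g * x`. -/
lemma translation_commutator (g x : H) : b (g * x * g⁻¹ * x⁻¹) =
    (A g - 1) (b x) - (A x - 1) (b g) - (A (g * x * g⁻¹ * x⁻¹) - 1) (b (x * g)) := by
  have h1 := hA.map_mul (g * x * g⁻¹ * x⁻¹) (x * g)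
  rw [show g * x * g⁻¹ * x⁻¹ * (x * g) = g * x by group, hA.map_mul g x] at h1
  have h2 := hA.map_mul x g
  have h1 := eq_sub_of_add_eq' h1.symm
  simp only [sub_apply, one_apply_eq_self]
  rw [h1, h2]
  abel

lemma norm_commutator_linear_le (g x : H) :
    ‖A (g * x * g⁻¹ * x⁻¹) - 1‖ ≤ 2 * ‖A g - 1‖ * ‖A x - 1‖ := by
  have e : A (g * x * g⁻¹ * x⁻¹) - 1 =
      ((A g - 1) * (A x - 1) - (A x - 1) * (A g - 1)) * A (x * g)⁻¹ := by
    have e2 : A (x * g) * A (x * g)⁻¹ = 1 := by rw [← _root_.map_mul]; simp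
    have e3 : (A g - 1) * (A x - 1) - (A x - 1) * (A g - 1) = A (g * x) - A (x * g) := by
      simp only [_root_.map_mul]; noncomm_ring
    rw [e3, sub_mul, e2, ← _root_.map_mul]
    congr 2; group
  rw [e]
  refine (hA.norm_mul_le_right _ _).trans ((norm_sub_le _ _).trans ?_)
  have h1 := norm_mul_le (A g - 1) (A x - 1)
  have h2 := norm_mul_le (A x - 1) (A g - 1)
  linarith

/-- Weighted size of an element, contracted by taking commutators with a small rotation `g`. -/
lemma weight_commutator_le {g x : H} (hg : ‖A g - 1‖ ≤ 1 / 4) (hx : ‖A x - 1‖ ≤ 1 / 4) :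
    ‖A (g * x * g⁻¹ * x⁻¹) - 1‖ ≤ ‖A x - 1‖ / 2 ∧
    ‖b (g * x * g⁻¹ * x⁻¹)‖ + (8 * ‖b g‖ + 1) * ‖A (g * x * g⁻¹ * x⁻¹) - 1‖ ≤
      3 / 4 * (‖b x‖ + (8 * ‖b g‖ + 1) * ‖A x - 1‖) := by
  have h1 : ‖A (g * x * g⁻¹ * x⁻¹) - 1‖ ≤ ‖A x - 1‖ / 2 := by
    have := hA.norm_commutator_linear_le g x
    nlinarith [norm_nonneg (A x - 1)]
  refine ⟨h1, ?_⟩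
  have h2 : ‖b (x * g)‖ ≤ ‖b g‖ + ‖b x‖ := by
    rw [hA.map_mul]
    exact (norm_add_le _ _).trans (by rw [hA.norm_map])
  have h3 : ‖b (g * x * g⁻¹ * x⁻¹)‖ ≤ ‖A g - 1‖ * ‖b x‖ + ‖A x - 1‖ * ‖b g‖ +
      ‖A (g * x * g⁻¹ * x⁻¹) - 1‖ * ‖b (x * g)‖ := by
    rw [hA.translation_commutator]
    refine (norm_sub_le _ _).trans (add_le_add ((norm_sub_le _ _).trans (add_le_add ?_ ?_)) ?_) <;>
    exact ContinuousLinearMap.le_opNorm _ _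
  set β := ‖A x - 1‖
  set β' := ‖A (g * x * g⁻¹ * x⁻¹) - 1‖
  have h4 : ‖A g - 1‖ * ‖b x‖ ≤ 1 / 4 * ‖b x‖ := by gcongr
  have h5 : β' * ‖b (x * g)‖ ≤ β / 2 * ‖b g‖ + 1 / 8 * ‖b x‖ := by
    calc β' * ‖b (x * g)‖ ≤ β' * (‖b g‖ + ‖b x‖) := by gcongr
      _ = β' * ‖b g‖ + β' * ‖b x‖ := by ring
      _ ≤ β / 2 * ‖b g‖ + 1 / 8 * ‖b x‖ := by gcongr; linarith
  -- The rotation part is halved while only the factor `3 / 4` is claimed; with the weight `8 * ‖b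
  -- g‖` the slack pays for the terms `β * ‖b g‖` of `h3` and `h5`.
  have h6 : (8 * ‖b g‖ + 1) * β' ≤ (8 * ‖b g‖ + 1) * (β / 2) := by gcongr
  have h7 : 0 ≤ β * ‖b g‖ := by positivity
  have h8 : 0 ≤ β := norm_nonneg _
  nlinarith [norm_nonneg (b x)]

/-- Two elements of a discrete group with small rotational parts have commuting rotational parts,
and their commutator is a translation fixed by them. -/
lemma small_rotations (hfin : {h | ‖b h‖ ≤ 1}.Finite) {g h : H} (hg : ‖A g - 1‖ ≤ 1 / 4)
    (hh : ‖A h - 1‖ ≤ 1 / 4) : A (g * h * g⁻¹ * h⁻¹) = 1 ∧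
      (A g - 1) ((A g - 1) (b h) - (A h - 1) (b g)) = 0 := by
  -- The weights of the iterated commutators with `g` tend to 0, and discreteness makes one vanish,
  -- so some iterate acts trivially. The conclusion is then carried back down to `s 1`.
  obtain ⟨s, s_zero, s_succ⟩ : ∃ s : ℕ → H, s 0 = h ∧
      ∀ n, s (n + 1) = g * s n * g⁻¹ * (s n)⁻¹ :=
    ⟨fun n => Nat.rec h (fun _ x => g * x * g⁻¹ * x⁻¹) n, rfl, fun _ => rfl⟩
  set W : H → ℝ := fun x => ‖b x‖ + (8 * ‖b g‖ + 1) * ‖A x - 1‖ with hW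
  have hsmall : ∀ n, ‖A (s n) - 1‖ ≤ 1 / 4 := by
    intro n
    induction n with
    | zero => rwa [s_zero]
    | succ n ih =>
      have := (hA.weight_commutator_le hg ih).1
      rw [s_succ]
      linarith
  have hWle : ∀ n, W (s n) ≤ (3 / 4) ^ n * W h := by
    intro n
    induction n with
    | zero => simp [s_zero]
    | succ n ih =>
      have := (hA.weight_commutator_le hg (hsmall n)).2
      rw [← s_succ] at this
      rw [pow_succ]
      calc W (s (n + 1)) ≤ 3 / 4 * W (s n) := this
        _ ≤ 3 / 4 * ((3 / 4) ^ n * W h) := by gcongr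
        _ = _ := by ring
  have hW0 : ∀ x, 0 ≤ W x := fun x => by positivity
  have hlim : Filter.Tendsto (fun n => W (s n)) Filter.atTop (nhds 0) := by
    refine squeeze_zero (fun _ => hW0 _) hWle ?_
    rw [← zero_mul (W h)]
    exact (tendsto_pow_atTop_nhds_zero_of_lt_one (by norm_num) (by norm_num)).mul_const _
  obtain ⟨n, hn⟩ : ∃ n, W (s (n + 1)) = 0 := by
    -- Only finitely many elements have `‖b h‖ ≤ 1`, so 0 is isolated among their weights.
    have hZ : (W '' {h | ‖b h‖ ≤ 1} \ {0}).Finite := (hfin.image W).sdiff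
    have h1 := hlim.eventually (hZ.isClosed.isOpen_compl.mem_nhds (x := (0 : ℝ)) (by simp))
    have h2 := hlim.eventually (gt_mem_nhds (zero_lt_one' ℝ))
    obtain ⟨n, hn1, hn2⟩ := ((Filter.tendsto_add_atTop_nat 1).eventually (h1.and h2)).exists
    refine ⟨n, ?_⟩
    by_contra hne
    refine hn1 ⟨⟨s (n + 1), ?_, rfl⟩, hne⟩
    have : 0 ≤ (8 * ‖b g‖ + 1) * ‖A (s (n + 1)) - 1‖ := by positivity
    simp only [hW] at hn2
    simp only [Set.mem_ofPred_eq]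
    linarith
  have hAn : A (s (n + 1)) = 1 := by
    have h1 : 0 ≤ ‖b (s (n + 1))‖ := norm_nonneg _
    have h2 : ‖A (s (n + 1)) - 1‖ ≤ 0 := by
      simp only [hW] at hn
      nlinarith [norm_nonneg (b g), norm_nonneg (A (s (n + 1)) - 1),
        mul_nonneg (norm_nonneg (b g)) (norm_nonneg (A (s (n + 1)) - 1))]
    exact sub_eq_zero.1 (norm_le_zero_iff.1 h2)
  have hbn : b (s (n + 1)) = 0 := by
    simp only [hW, hAn, sub_self, norm_zero, mul_zero, add_zero] at hn
    exact norm_eq_zero.1 hn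
  -- If the rotation of `s (k + 2)` is trivial, then `A g` commutes with that of `s (k + 1) = [g, s
  -- k]`, and `commutator_linear_eq_one` applies.
  have hdown : ∀ k, A (s (k + 1)) = 1 → A (s 1) = 1 := by
    intro k
    induction k with
    | zero => exact id
    | succ k ih =>
      intro hk
      refine ih (s_succ k ▸ hA.commutator_linear_eq_one (g := g) (hsmall k) ?_)
      rw [s_succ (k + 1), _root_.map_mul, _root_.map_mul, _root_.map_mul] at hk
      have e1 : A g⁻¹ * A g = 1 := by rw [← _root_.map_mul]; simp
      have e2 : A (s (k + 1))⁻¹ * A (s (k + 1)) = 1 := by rw [← _root_.map_mul]; simp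
      rw [← s_succ]
      calc A g * A (s (k + 1)) = A g * A (s (k + 1)) * (A g⁻¹ * (A (s (k + 1))⁻¹ *
            A (s (k + 1))) * A g) := by rw [e2, mul_one, e1, mul_one]
        _ = (A g * A (s (k + 1)) * A g⁻¹ * A (s (k + 1))⁻¹) * A (s (k + 1)) * A g := by
          simp only [mul_assoc]
        _ = _ := by rw [hk, one_mul]
  have hA1 := hdown n hAn
  have hAk : ∀ k, A (s (k + 1)) = 1 := by
    intro k
    induction k with
    | zero => exact hA1
    | succ k ih =>
      have e1 : A g * A g⁻¹ = 1 := by rw [← _root_.map_mul]; simp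
      have e2 : A (s (k + 1))⁻¹ = 1 := by
        have : A (s (k + 1)) * A (s (k + 1))⁻¹ = 1 := by rw [← _root_.map_mul]; simp
        rwa [ih, one_mul] at this
      rw [s_succ, _root_.map_mul, _root_.map_mul, _root_.map_mul, ih, e2, mul_one, mul_one, e1]
  -- With trivial rotations, a commutator with `g` just applies `A g - 1` to the translation part; a
  -- vanishing iterate of `A g - 1` collapses to the first one because `A g` is an isometry.
  have hbk : ∀ k, b (s (k + 2)) = (A g - 1) (b (s (k + 1))) := by
    intro k
    have := hA.translation_commutator g (s (k + 1))
    rw [← s_succ, hAk, hAk] at this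
    simpa using this
  have hb1 : (A g - 1) (b (s 1)) = 0 := by
    have : ∀ k, b (s (k + 1)) = 0 → (A g - 1) (b (s 1)) = 0 := by
      intro k
      induction k with
      | zero => intro h; rw [h, map_zero]
      | succ k ih =>
        intro h
        rcases k with _ | k
        · rw [← hbk]; exact h
        · refine ih ?_
          rw [hbk] at h ⊢
          rw [hbk] at h
          exact map_eq_self_of_iterate (hA.norm_map g) h
    exact this n hbn
  have hs1 : g * h * g⁻¹ * h⁻¹ = s 1 := by rw [s_succ, s_zero]
  rw [hs1]
  refine ⟨hA1, ?_⟩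
  have := hA.translation_commutator g h
  rw [hs1, hA1] at this
  simp only [sub_self, zero_apply, sub_zero] at this
  rwa [← this]

/-- The point is that the bound is independent of `h`: by `small_rotations` and commutation the
vector equals `(A h - 1) ((A g - 1) (b g))`. -/
lemma norm_le_of_small_rotations (hfin : {h | ‖b h‖ ≤ 1}.Finite) {g h : H}
    (hg : ‖A g - 1‖ ≤ 1 / 4) (hh : ‖A h - 1‖ ≤ 1 / 4) :
    ‖(A g - 1) ((A g - 1) (b h))‖ ≤ 2 * ‖(A g - 1) (b g)‖ := by
  obtain ⟨h1, h2⟩ := hA.small_rotations hfin hg hh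
  have hcomm : A g * A h = A h * A g := by
    rw [← _root_.map_mul, ← _root_.map_mul, ← one_mul (A (h * g)), ← h1, ← _root_.map_mul]
    congr 1; group
  have hcomm' : (A g - 1) * (A h - 1) = (A h - 1) * (A g - 1) := by
    have : (A g - 1) * (A h - 1) - (A h - 1) * (A g - 1) = A g * A h - A h * A g := by noncomm_ring
    rw [← sub_eq_zero, this, hcomm, sub_self]
  rw [map_sub, sub_eq_zero] at h2
  have e : (A g - 1) ((A h - 1) (b g)) = (A h - 1) ((A g - 1) (b g)) :=
    congrArg (fun L : E →L[ℝ] E => L (b g)) hcomm'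
  rw [h2, e, sub_apply]
  refine (norm_sub_le _ _).trans ?_
  rw [hA.norm_map, one_apply_eq_self]
  linarith

lemma exists_finite_approx [FiniteDimensional ℝ E] :
    ∃ I : Set H, I.Finite ∧ ∀ h, ∃ i ∈ I, ‖A h - A i‖ ≤ 1 / 4 := by
  have : ProperSpace (E →L[ℝ] E) := FiniteDimensional.proper ℝ _
  have htb : TotallyBounded (Set.range A) := by
    refine (isCompact_closedBall (0 : E →L[ℝ] E) 1).totallyBounded.subset ?_
    rintro _ ⟨h, rfl⟩
    simpa using hA.norm_le_one h
  obtain ⟨t, hts, htf, ht⟩ := Metric.finite_approx_of_totallyBounded htb (1 / 4) (by norm_num)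
  have : ∀ x ∈ t, ∃ h, A h = x := fun x hx => hts hx
  choose! f hf using this
  refine ⟨f '' t, htf.image f, fun h => ?_⟩
  obtain ⟨x, hx, hxb⟩ := Set.mem_iUnion₂.1 (ht ⟨h, rfl⟩)
  refine ⟨f x, ⟨x, hx, rfl⟩, ?_⟩
  rw [hf x hx, ← dist_eq_norm]
  exact (Metric.mem_ball.1 hxb).le

/-- Every `x` is near some `b h`, and `h` differs from one of finitely many `i` by a small rotation,
so `(A g - 1) ^ 2 * A i⁻¹` is bounded at `x` by a constant independent of `x`. Applied to all
multiples of `x`, the pigeonhole principle puts `x` in the kernel for some `i`. Finitely many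
subspaces covering `E` include `E` itself, so `(A g - 1) ^ 2 = 0`. -/
lemma linear_eq_one_of_small [FiniteDimensional ℝ E] (hfin : {h | ‖b h‖ ≤ 1}.Finite) {R : ℝ}
    (hco : ∀ x, ∃ h, ‖b h - x‖ ≤ R) {g : H} (hg : ‖A g - 1‖ ≤ 1 / 4) : A g = 1 := by
  obtain ⟨I, hIf, hI⟩ := hA.exists_finite_approx
  obtain ⟨C, hC⟩ := (hIf.image fun i => ‖b i⁻¹‖).bddAbove
  have hC : ∀ i ∈ I, ‖b i⁻¹‖ ≤ C := fun i hi => hC ⟨i, hi, rfl⟩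
  set N : E →L[ℝ] E := (A g - 1) * (A g - 1) with hN
  set M := 2 * ‖(A g - 1) (b g)‖ + ‖N‖ * (C + R) with hM
  have key : ∀ x : E, ∃ i : I, ‖(N * A i.1⁻¹) x‖ ≤ M := by
    intro x
    obtain ⟨h, hh⟩ := hco x
    obtain ⟨i, hi, hih⟩ := hI h
    refine ⟨⟨i, hi⟩, ?_⟩
    have hs : ‖A (i⁻¹ * h) - 1‖ ≤ 1 / 4 := by
      have : A (i⁻¹ * h) - 1 = A i⁻¹ * (A h - A i) := by
        rw [mul_sub, ← _root_.map_mul, ← _root_.map_mul]; simp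
      rw [this]
      exact (hA.norm_mul_le_left _ _).trans hih
    have h1 : ‖N (b (i⁻¹ * h))‖ ≤ 2 * ‖(A g - 1) (b g)‖ :=
      hA.norm_le_of_small_rotations hfin hg hs
    have e : (N * A i⁻¹) x = N (b (i⁻¹ * h)) - N (b i⁻¹ + A i⁻¹ (b h - x)) := by
      rw [← map_sub, hA.map_mul]
      simp only [mul_apply_eq_comp, map_sub, map_add]
      abel
    rw [e]
    refine (norm_sub_le _ _).trans (add_le_add h1 ((N.le_opNorm _).trans ?_))
    gcongr
    refine (norm_add_le _ _).trans (add_le_add (hC i hi) ?_)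
    rw [hA.norm_map]; exact hh
  have hIfin : Finite I := hIf
  have hun : ⋃ i : I, ((N * A i.1⁻¹ : E →L[ℝ] E).ker : Set E) = Set.univ := by
    refine Set.eq_univ_of_forall fun x => ?_
    choose f hf using fun n : ℕ => key ((n : ℝ) • x)
    obtain ⟨i, hi⟩ := Finite.exists_infinite_fiber f
    refine Set.mem_iUnion.2 ⟨i, ?_⟩
    change (N * A i.1⁻¹) x = 0
    by_contra hne
    obtain ⟨m, hm⟩ := exists_nat_gt (M / ‖(N * A i.1⁻¹) x‖)
    rw [div_lt_iff₀ (norm_pos_iff.2 hne)] at hm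
    obtain ⟨n, hn, hmn⟩ := (Set.infinite_coe_iff.1 hi).exists_gt m
    have h1 := hf n
    rw [show f n = i from hn, map_smul, norm_smul, Real.norm_of_nonneg (Nat.cast_nonneg n)] at h1
    have h2 : (m : ℝ) ≤ n := by exact_mod_cast hmn.le
    nlinarith [norm_nonneg ((N * A i.1⁻¹) x)]
  obtain ⟨i, hi⟩ := Subspace.exists_eq_top_of_iUnion_eq_univ hun
  ext x
  have h1 : (N * A i.1⁻¹) (A i.1 x) = 0 := by
    have : A i.1 x ∈ (N * A i.1⁻¹ : E →L[ℝ] E).ker := hi ▸ Submodule.mem_top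
    exact this
  have h2 : A i.1⁻¹ (A i.1 x) = x := by
    rw [← mul_apply_eq_comp, ← _root_.map_mul]; simp
  rw [mul_apply_eq_comp, h2] at h1
  have := map_eq_self_of_iterate (hA.norm_map g) h1
  simpa [sub_eq_zero] using this

/-- **Bieberbach**: the translations in a discrete cocompact group of isometries of a
finite-dimensional space form a cocompact subgroup. -/
theorem exists_translation_near [FiniteDimensional ℝ E] (hfin : {h | ‖b h‖ ≤ 1}.Finite) {R : ℝ}
    (hco : ∀ x, ∃ h, ‖b h - x‖ ≤ R) : ∃ R', ∀ x, ∃ h, A h = 1 ∧ ‖b h - x‖ ≤ R' := by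
  obtain ⟨I, hIf, hI⟩ := hA.exists_finite_approx
  obtain ⟨C, hC⟩ := (hIf.image fun i => ‖b i⁻¹‖).bddAbove
  have hC : ∀ i ∈ I, ‖b i⁻¹‖ ≤ C := fun i hi => hC ⟨i, hi, rfl⟩
  refine ⟨C + R, fun x => ?_⟩
  obtain ⟨h, hh⟩ := hco x
  obtain ⟨i, hi, hih⟩ := hI h
  refine ⟨h * i⁻¹, hA.linear_eq_one_of_small hfin hco ?_, ?_⟩
  · have : A (h * i⁻¹) - 1 = (A h - A i) * A i⁻¹ := by
      rw [sub_mul, ← _root_.map_mul, ← _root_.map_mul]; simp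
    rw [this]
    exact (hA.norm_mul_le_right _ _).trans hih
  · rw [hA.map_mul, add_sub_assoc]
    refine (norm_add_le _ _).trans (add_le_add ?_ hh)
    rw [hA.norm_map]; exact hC i hi

end IsIsometricAffine

end Bieberbach

/-! ### Minimising displacements in the target space. -/

section Displacement

variable {G : Type w} {Y : Type v} [Group G] [MetricSpace Y] [MulAction G Y]

/-- The total displacement of `y` under the elements of `s`. -/
noncomputable def displacement (s : Finset G) (y : Y) : ℝ := ∑ c ∈ s, dist y (c • y)

lemma displacement_nonneg (s : Finset G) (y : Y) : 0 ≤ displacement s y :=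
  Finset.sum_nonneg fun _ _ => dist_nonneg

lemma IsGeometricAction.displacement_smul (hG : IsGeometricAction G Y) {s : Finset G} {t : G}
    (ht : ∀ c ∈ s, t * c * t⁻¹ ∈ s) (ht' : ∀ c ∈ s, t⁻¹ * c * t ∈ s) (y : Y) :
    displacement s (t • y) = displacement s y := by
  refine Finset.sum_bij' (fun c _ => t⁻¹ * c * t) (fun c _ => t * c * t⁻¹) ht' ht
    (fun c _ => by group) (fun c _ => by group) (fun c _ => ?_)
  rw [← hG.dist_smul t y, smul_smul, smul_smul]
  congr 2; group

lemma IsGeometricAction.displacement_le (hG : IsGeometricAction G Y) (s : Finset G) (y z : Y) :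
    displacement s y ≤ displacement s z + 2 * s.card * dist y z := by
  have : ∀ c ∈ s, dist y (c • y) ≤ dist z (c • z) + 2 * dist y z := by
    intro c _
    have := dist_triangle4 y z (c • z) (c • y)
    rw [hG.dist_smul, dist_comm z y] at this
    linarith
  refine (Finset.sum_le_sum this).trans (le_of_eq ?_)
  rw [Finset.sum_add_distrib, Finset.sum_const, nsmul_eq_mul, displacement]
  ring

lemma IsGeometricAction.dist_midpoint_le (hG : IsGeometricAction G Y) (hY : IsCAT0 Y)
    {c : ℝ → Y} (hc : IsLinearGeodesic c) (q : G) : dist (c (1 / 2)) (q • c (1 / 2)) ≤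
      (dist (c 0) (q • c 0) + dist (c 1) (q • c 1)) / 2 := by
  have := hY.dist_le hc (hc.comp_isometry (hG.isometric.isometry_smul q)) (θ := 1 / 2)
    ⟨by norm_num, by norm_num⟩
  linarith

/-- Moving `y` into a compact fundamental set by `g⁻¹` turns `S` into conjugates of bounded
displacement, for which only finitely many tuples are possible. Two elements `g` giving the same
tuple differ by an element centralizing `S`. -/
lemma IsGeometricAction.exists_isCompact_centralizer (hG : IsGeometricAction G Y) [ProperSpace Y]
    {S : Set G} (hS : S.Finite) (R : ℝ) : ∃ K : Set Y, IsCompact K ∧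
      ∀ y : Y, (∀ s ∈ S, dist y (s • y) ≤ R) → ∃ c : G, (∀ s ∈ S, Commute c s) ∧ c • y ∈ K := by
  classical
  obtain ⟨K, hK, hcov⟩ := hG.cocompact
  rcases isEmpty_or_nonempty Y with hE | ⟨⟨y₀⟩⟩
  · exact ⟨∅, isCompact_empty, fun y => hE.elim y⟩
  obtain ⟨ρ, hρ⟩ := hK.isBounded.subset_closedBall y₀
  set Q : Set G := {q | dist (q • y₀) y₀ ≤ 2 * ρ + R}
  have hQ : Q.Finite := hG.finite_setOf_dist_le y₀ y₀ _
  have : Finite S := hS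
  have hM : {μ : S → G | ∀ s, μ s ∈ Q}.Finite := Set.Finite.pi' fun _ => hQ
  set rep : (S → G) → G := fun μ =>
    if h : ∃ g : G, ∀ s : S, g⁻¹ * s * g = μ s then h.choose else 1 with hrep
  refine ⟨⋃ μ ∈ {μ : S → G | ∀ s, μ s ∈ Q}, (fun y : Y => rep μ • y) '' K,
    hM.isCompact_biUnion fun μ _ => hK.image (hG.isometric.isometry_smul _).continuous,
    fun y hy => ?_⟩
  obtain ⟨g, k, hk, rfl⟩ := exists_smul_mem_of_iUnion_eq hcov y
  set μ : S → G := fun s => g⁻¹ * s * g with hμ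
  have hex : ∃ g : G, ∀ s : S, g⁻¹ * s * g = μ s := ⟨g, fun _ => rfl⟩
  have hr : ∀ s ∈ S, (rep μ)⁻¹ * s * rep μ = g⁻¹ * s * g := by
    intro s hs
    have := hex.choose_spec ⟨s, hs⟩
    simp only [hrep, dif_pos hex]
    exact this
  refine ⟨rep μ * g⁻¹, fun s hs => ?_, ?_⟩
  · have := hr s hs
    have e : s * (rep μ * g⁻¹) = rep μ * ((rep μ)⁻¹ * s * rep μ) * g⁻¹ := by group
    rw [Commute, SemiconjBy, e, this]
    group
  · refine Set.mem_biUnion (x := μ) (fun s => ?_) ⟨k, hk, by simp [mul_smul]⟩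
    have h1 := hy s s.2
    have h2 : dist k (μ s • k) ≤ R := by
      rw [← hG.dist_smul g, smul_smul]
      convert h1 using 2
      rw [smul_smul, hμ]; congr 1; group
    have h3 := Metric.mem_closedBall.1 (hρ hk)
    change dist (μ s • y₀) y₀ ≤ 2 * ρ + R
    have h4 := dist_triangle4 (μ s • y₀) (μ s • k) k y₀
    rw [hG.dist_smul, dist_comm y₀, dist_comm _ k] at h4
    linarith

lemma IsGeometricAction.countable (hG : IsGeometricAction G Y) [ProperSpace Y] (y : Y) :
    Countable G := by
  have : (Set.univ : Set G) = ⋃ n : ℕ, {g : G | dist (g • y) y ≤ n} := by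
    ext g
    simpa using exists_nat_ge (dist (g • y) y)
  rw [← Set.countable_univ_iff, this]
  exact Set.countable_iUnion fun n => (hG.finite_setOf_dist_le y y n).countable

/-- A finitely generated group `T` with finite conjugacy classes has a point which is moved twice
as far by `a ^ 2` as by `a`, for all `a` in `T`. -/
theorem IsGeometricAction.exists_dist_sq_eq (hG : IsGeometricAction G Y) (hY : IsCAT0 Y)
    [ProperSpace Y] [Nonempty Y] (T : Subgroup G) {S : Set G} (hS : S.Finite)
    (hST : Subgroup.closure S = T) (hfc : ∀ a ∈ T, {c | ∃ t ∈ T, c = t * a * t⁻¹}.Finite) :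
    ∃ y : Y, ∀ a ∈ T, dist y (a • a • y) = 2 * dist y (a • y) := by
  classical
  obtain ⟨y₀⟩ := ‹Nonempty Y›
  have := hG.countable y₀
  let := Encodable.ofCountable T
  obtain ⟨ε, hε, E, hE, -⟩ := posSumOfEncodable one_pos T
  set C : T → Finset G := fun a => (hfc a a.2).toFinset with hC
  have mem_C : ∀ (a : T) (c : G), c ∈ C a ↔ ∃ t ∈ T, c = t * a * t⁻¹ := by simp [hC]
  have self_mem : ∀ a : T, (a : G) ∈ C a := fun a => (mem_C a a).2 ⟨1, T.one_mem, by simp⟩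
  have C_sub : ∀ (a : T), ∀ c ∈ C a, c ∈ T := by
    intro a c hc
    obtain ⟨t, ht, rfl⟩ := (mem_C a c).1 hc
    exact T.mul_mem (T.mul_mem ht a.2) (T.inv_mem ht)
  set D : T → Y → ℝ := fun a => displacement (C a)
  have hD0 : ∀ a y, 0 ≤ D a y := fun a y => displacement_nonneg _ _
  have hDT : ∀ a, ∀ t ∈ T, ∀ y, D a (t • y) = D a y := by
    intro a t ht y
    refine hG.displacement_smul (fun c hc => ?_) (fun c hc => ?_) y <;>
    obtain ⟨r, hr, rfl⟩ := (mem_C a c).1 hc <;> rw [mem_C]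
    · exact ⟨t * r, T.mul_mem ht hr, by group⟩
    · exact ⟨t⁻¹ * r, T.mul_mem (T.inv_mem ht) hr, by group⟩
  have hDc : ∀ a (c : G), (∀ s ∈ S, Commute c s) → ∀ y, D a (c • y) = D a y := by
    intro a c hc y
    have hcT : ∀ t ∈ T, Commute c t := by
      intro t ht
      rw [← hST] at ht
      induction ht using Subgroup.closure_induction with
      | mem s hs => exact hc s hs
      | one => exact Commute.one_right c
      | mul s t _ _ h1 h2 => exact h1.mul_right h2
      | inv s _ h => exact h.inv_right
    refine hG.displacement_smul (fun q hq => ?_) (fun q hq => ?_) y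
    · rw [(hcT q (C_sub a q hq)).eq, mul_inv_cancel_right]; exact hq
    · rw [mul_assoc, ← (hcT q (C_sub a q hq)).eq, inv_mul_cancel_left]; exact hq
  -- This normalisation bounds both the value at `y₀` and the Lipschitz constant of the `a`-th term
  -- by `ε a`, so the series converges and its sum is Lipschitz.
  set den : T → ℝ := fun a => 1 + D a y₀ + 2 * (C a).card with hden
  have hden0 : ∀ a, 0 < den a := fun a => by have := hD0 a y₀; positivity
  set f : T → Y → ℝ := fun a y => ε a / den a * D a y with hf
  have hcoef : ∀ a, 0 < ε a / den a := fun a => div_pos (hε a) (hden0 a)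
  have hf0 : ∀ a y, 0 ≤ f a y := fun a y => mul_nonneg (hcoef a).le (hD0 a y)
  have hflip : ∀ a y z, f a y ≤ f a z + ε a * dist y z := by
    intro a y z
    have h1 := hG.displacement_le (C a) y z
    have h2 : ε a / den a * (2 * (C a).card) ≤ ε a := by
      rw [div_mul_eq_mul_div, div_le_iff₀ (hden0 a)]
      have := hD0 a y₀
      exact mul_le_mul_of_nonneg_left (by rw [hden]; linarith) (hε a).le
    calc f a y ≤ ε a / den a * (D a z + 2 * (C a).card * dist y z) :=
          mul_le_mul_of_nonneg_left h1 (hcoef a).le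
      _ = f a z + ε a / den a * (2 * (C a).card) * dist y z := by rw [hf]; ring
      _ ≤ _ := by gcongr
  have hfy₀ : ∀ a, f a y₀ ≤ ε a := by
    intro a
    rw [hf]
    simp only
    rw [div_mul_eq_mul_div, div_le_iff₀ (hden0 a)]
    refine mul_le_mul_of_nonneg_left ?_ (hε a).le
    rw [hden]
    simp only
    linarith [(C a).card.cast_nonneg (α := ℝ)]
  have hsum : ∀ y, Summable fun a => f a y := by
    intro y
    refine Summable.of_nonneg_of_le (fun a => hf0 a y)
      (fun a => (hflip a y y₀).trans (add_le_add_left (hfy₀ a) _)) ?_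
    exact hE.summable.add (hE.summable.mul_right _)
  set Φ : Y → ℝ := fun y => ∑' a, f a y with hΦ
  have hΦlip : ∀ y z, Φ y ≤ Φ z + E * dist y z := by
    intro y z
    rw [hΦ]
    simp only
    rw [← hE.tsum_eq, ← tsum_mul_right, ← (hsum z).tsum_add (hE.summable.mul_right _)]
    exact (hsum y).tsum_le_tsum (fun a => hflip a y z)
      ((hsum z).add (hE.summable.mul_right _))
  have hΦcont : Continuous Φ := by
    have hE0 : 0 ≤ E := hE.nonneg fun a => (hε a).le
    refine (LipschitzWith.of_le_add_mul ⟨E, hE0⟩ hΦlip).continuous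
  have hΦcongr : ∀ {y z}, (∀ a, D a y = D a z) → Φ y = Φ z := by
    intro y z h
    simp only [hΦ, hf, h]
  -- `R` bounds how far generators move a point with `Φ y ≤ Φ y₀`; the default 0 is harmless since
  -- `S` lies in `T`.
  obtain ⟨R, hR⟩ := (hS.image fun s =>
    if h : s ∈ T then Φ y₀ / (ε ⟨s, h⟩ / den ⟨s, h⟩) else 0).bddAbove
  obtain ⟨K, hK, hKy⟩ := hG.exists_isCompact_centralizer hS R
  obtain ⟨y₁, -, hy₁⟩ := (hK.insert y₀).exists_isMinOn (Set.insert_nonempty _ _) hΦcont.continuousOn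
  have hmin : ∀ y, Φ y₁ ≤ Φ y := by
    intro y
    have h0 : Φ y₁ ≤ Φ y₀ := hy₁ (Set.mem_insert _ _)
    rcases le_total (Φ y₀) (Φ y) with h | h
    · exact h0.trans h
    · obtain ⟨c, hc, hcK⟩ := hKy y (by
        intro s hs
        have hsT : s ∈ T := hST ▸ Subgroup.subset_closure hs
        refine le_trans ?_ (hR ⟨s, hs, rfl⟩)
        simp only
        rw [dif_pos hsT, le_div_iff₀ (hcoef _), mul_comm]
        refine le_trans ?_ (((hsum y).le_tsum ⟨s, hsT⟩ fun a _ => hf0 a y).trans h)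
        refine mul_le_mul_of_nonneg_left ?_ (hcoef _).le
        exact Finset.single_le_sum (f := fun c => dist y (c • y)) (fun _ _ => dist_nonneg)
          (self_mem ⟨s, hsT⟩))
      rw [← hΦcongr fun a => hDc a c hc y]
      exact hy₁ (Set.mem_insert_of_mem _ hcK)
  refine ⟨y₁, fun a ha => ?_⟩
  -- By convexity and `T`-invariance no class displacement grows on passing to the midpoint `m` of
  -- `y₁` and `a • y₁`. Minimality of `Φ` forces equality for every class, hence for `a` itself.
  obtain ⟨c, hc, hc0, hc1⟩ := hY.exists_isLinearGeodesic y₁ (a • y₁)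
  set m := c (1 / 2) with hm
  have hmid : ∀ q : G, dist m (q • m) ≤ (dist y₁ (q • y₁) + dist (a • y₁) (q • a • y₁)) / 2 := by
    intro q
    have := hG.dist_midpoint_le hY hc q
    rwa [hc0, hc1] at this
  have havg : ∀ t : T, ∑ q ∈ C t, (dist y₁ (q • y₁) + dist (a • y₁) (q • a • y₁)) / 2 =
      D t y₁ := by
    intro t
    rw [← Finset.sum_div, Finset.sum_add_distrib]
    change (D t y₁ + D t (a • y₁)) / 2 = _
    rw [hDT t a ha]; ring
  have hDm : ∀ t, D t m ≤ D t y₁ := fun t =>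
    (Finset.sum_le_sum fun q _ => hmid q).trans (havg t).le
  have hDeq : ∀ t, D t m = D t y₁ := by
    intro t
    by_contra hne
    have hlt : D t m < D t y₁ := lt_of_le_of_ne (hDm t) hne
    refine absurd (hmin m) (not_le.2 ?_)
    exact (hsum m).tsum_lt_tsum (i := t)
      (fun s => mul_le_mul_of_nonneg_left (hDm s) (hcoef s).le)
      (mul_lt_mul_of_pos_left hlt (hcoef t)) (hsum y₁)
  have heq : dist m (a • m) = (dist y₁ (a • y₁) + dist (a • y₁) (a • a • y₁)) / 2 := by
    by_contra hne
    have hlt := lt_of_le_of_ne (hmid a) hne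
    have := Finset.sum_lt_sum (s := C ⟨a, ha⟩) (fun q _ => hmid q) ⟨a, self_mem ⟨a, ha⟩, hlt⟩
    rw [havg] at this
    exact absurd (hDeq ⟨a, ha⟩) this.ne
  rw [hG.dist_smul] at heq
  -- `m` and `a • m` are midpoints of two sides issuing from `a • y₁`, so their distance is at most
  -- half of the third side.
  have hle := hY.dist_le_of_start_eq hc.symm (hc.comp_isometry (hG.isometric.isometry_smul a))
    (by simp [hc0, hc1]) (θ := 1 / 2) ⟨by norm_num, by norm_num⟩
  norm_num only [sub_self] at hle
  rw [hc0, hc1, ← hm] at hle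
  refine le_antisymm ?_ (by linarith)
  have := dist_triangle y₁ (a • y₁) (a • a • y₁)
  rw [hG.dist_smul] at this
  linarith

end Displacement

/-! ### Local finiteness of flats and their translation groups. -/

section FlatStabilizers

open scoped Pointwise

variable {G : Type w} {X : Type u} [Group G] [MetricSpace X] [MulAction G X]

lemma exists_dist_le_of_mem_cthickening {F : Set X} {L : ℝ≥0} {x : X}
    (hx : x ∈ Metric.cthickening L F) : ∃ p ∈ F, dist x p ≤ L + 1 := by
  rw [Metric.mem_cthickening_iff] at hx
  have : Metric.infEDist x F < ENNReal.ofReal (L + 1) :=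
    hx.trans_lt ((ENNReal.ofReal_lt_ofReal_iff (by positivity)).2 (lt_add_one _))
  obtain ⟨p, hp, hd⟩ := Metric.infEDist_lt_iff.1 this
  refine ⟨p, hp, ?_⟩
  rw [edist_dist] at hd
  exact ((ENNReal.ofReal_lt_ofReal_iff (by positivity)).1 hd).le

lemma IsFlat.exists_dist_eq {F : Set X} (hF : IsFlat F) {p : X} (hp : p ∈ F) {r : ℝ}
    (hr : 0 ≤ r) : ∃ q ∈ F, dist p q = r := by
  obtain ⟨k, hk, φ, hφ, rfl⟩ := hF
  obtain ⟨x, rfl⟩ := hp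
  have : NeZero k := ⟨by omega⟩
  refine ⟨φ (x + EuclideanSpace.single 0 r), ⟨_, rfl⟩, ?_⟩
  rw [hφ.dist_eq, dist_self_add_right]
  simp [abs_of_nonneg hr]

/-- A family of isolated flats is locally finite. -/
lemma finite_setOf_flats_meeting [ProperSpace X] {𝓕 : Set (Set X)} (hflat : ∀ F ∈ 𝓕, IsFlat F)
    {r : ℝ≥0} (hψ : ∀ F₁ ∈ 𝓕, ∀ F₂ ∈ 𝓕, F₁ ≠ F₂ →
      Metric.ediam (Metric.cthickening 1 F₁ ∩ Metric.cthickening 1 F₂) ≤ r)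
    {K : Set X} (hK : IsCompact K) : {F ∈ 𝓕 | (F ∩ K).Nonempty}.Finite := by
  classical
  rcases K.eq_empty_or_nonempty with rfl | ⟨k₀, -⟩
  · simp
  have : Nonempty X := ⟨k₀⟩
  obtain ⟨ρ, hρ⟩ := hK.isBounded.subset_closedBall k₀
  -- Infinitely many flats would give two whose pairs `(p, q)` are within distance 1, and their
  -- 1-neighborhoods would share two points at distance `r + 1`.
  have h1 : ∀ F ∈ {F ∈ 𝓕 | (F ∩ K).Nonempty}, ∃ p q : X, p ∈ F ∧ q ∈ F ∧ p ∈ K ∧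
      dist p q = r + 1 := by
    rintro F ⟨hF, p, hpF, hpK⟩
    obtain ⟨q, hq, hd⟩ := (hflat F hF).exists_dist_eq hpF (r := r + 1) (by positivity)
    exact ⟨p, q, hpF, hq, hpK, hd⟩
  choose! p q hp hq hpK hpq using h1
  by_contra hinf
  have hcomp : IsCompact (Metric.closedBall k₀ (ρ + r + 1) ×ˢ Metric.closedBall k₀ (ρ + r + 1)) :=
    (isCompact_closedBall _ _).prod (isCompact_closedBall _ _)
  obtain ⟨t, -, htf, ht⟩ :=
    Metric.finite_approx_of_totallyBounded hcomp.totallyBounded (1 / 2) (by norm_num)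
  have hmem : ∀ F ∈ {F ∈ 𝓕 | (F ∩ K).Nonempty}, ∃ c ∈ t, (p F, q F) ∈ Metric.ball c (1 / 2) := by
    intro F hF
    have hpb := Metric.mem_closedBall.1 (hρ (hpK F hF))
    have : (p F, q F) ∈ Metric.closedBall k₀ (ρ + r + 1) ×ˢ Metric.closedBall k₀ (ρ + r + 1) := by
      refine ⟨Metric.mem_closedBall.2 ?_, Metric.mem_closedBall.2 ?_⟩
      · simp only; linarith [r.coe_nonneg]
      · simp only
        linarith [dist_triangle (q F) (p F) k₀, dist_comm (q F) (p F), hpq F hF]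
    simpa using ht this
  choose! c hct hc using hmem
  obtain ⟨F₁, hF₁, F₂, hF₂, hne, heq⟩ := Set.Infinite.exists_ne_map_eq_of_mapsTo hinf hct htf
  have hd : dist (p F₁, q F₁) (p F₂, q F₂) ≤ 1 := by
    have e1 := Metric.mem_ball.1 (hc F₁ hF₁)
    have e2 := Metric.mem_ball.1 (hc F₂ hF₂)
    rw [← heq] at e2
    linarith [dist_triangle_right (p F₁, q F₁) (p F₂, q F₂) (c F₁)]
  rw [Prod.dist_eq, max_le_iff] at hd
  have hin : ∀ a b : X, a ∈ F₁ → b ∈ F₂ → dist a b ≤ 1 →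
      a ∈ Metric.cthickening 1 F₁ ∩ Metric.cthickening 1 F₂ := fun a b ha hb hab =>
    ⟨Metric.self_subset_cthickening _ ha, Metric.mem_cthickening_of_dist_le _ _ _ _ hb hab⟩
  have h2 := (Metric.edist_le_ediam_of_mem (hin _ _ (hp F₁ hF₁) (hp F₂ hF₂) hd.1)
    (hin _ _ (hq F₁ hF₁) (hq F₂ hF₂) hd.2)).trans (hψ F₁ hF₁.1 F₂ hF₂.1 hne)
  rw [edist_dist, hpq F₁ hF₁, ENNReal.ofReal_le_coe] at h2
  have h3 : ((r + 1 : ℝ).toNNReal : ℝ) = r + 1 := Real.coe_toNNReal _ (by positivity)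
  linarith

/-- The stabilizer of a member of a locally finite invariant family of sets acts cocompactly. -/
lemma IsGeometricAction.exists_stabilizer_near (hG : IsGeometricAction G X) {K : Set X}
    (hK : IsCompact K) (hcov : ⋃ g : G, (fun x : X => g • x) '' K = Set.univ)
    {𝓕 : Set (Set X)} (hinv : ∀ g : G, ∀ F ∈ 𝓕, g • F ∈ 𝓕)
    (hlf : {F ∈ 𝓕 | (F ∩ K).Nonempty}.Finite) {F : Set X} (hF : F ∈ 𝓕) (x₀ : X) :
    ∃ R : ℝ, ∀ p ∈ F, ∃ h ∈ MulAction.stabilizer G F, dist (h • x₀) p ≤ R := by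
  classical
  set rep : Set X → G := fun F' => if h : ∃ g : G, g • F' = F then h.choose else 1 with hrep
  obtain ⟨C, hC⟩ := (hlf.image fun F' => dist x₀ ((rep F')⁻¹ • x₀)).bddAbove
  obtain ⟨ρ, hρ⟩ := hK.isBounded.subset_closedBall x₀
  refine ⟨ρ + C, fun p hp => ?_⟩
  obtain ⟨g, k, hk, rfl⟩ := exists_smul_mem_of_iUnion_eq hcov p
  have hex : ∃ g' : G, g' • (g⁻¹ • F) = F := ⟨g, smul_inv_smul g F⟩
  have hrF : rep (g⁻¹ • F) • (g⁻¹ • F) = F := by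
    simp only [hrep, dif_pos hex]
    exact hex.choose_spec
  have hmem : g⁻¹ • F ∈ {F ∈ 𝓕 | (F ∩ K).Nonempty} :=
    ⟨hinv _ _ hF, k, Set.mem_inv_smul_set_iff.2 hp, hk⟩
  refine ⟨g * (rep (g⁻¹ • F))⁻¹, ?_, ?_⟩
  · rw [MulAction.mem_stabilizer_iff, mul_smul]
    rw [inv_smul_eq_iff.2 hrF.symm, smul_inv_smul]
  · rw [mul_smul, hG.dist_smul]
    have h1 : dist x₀ ((rep (g⁻¹ • F))⁻¹ • x₀) ≤ C := hC ⟨_, hmem, rfl⟩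
    have h2 := Metric.mem_closedBall.1 (hρ hk)
    linarith [dist_triangle_left ((rep (g⁻¹ • F))⁻¹ • x₀) k x₀, dist_comm k x₀]

variable {E : Type*} [NormedAddCommGroup E] [NormedSpace ℝ E] {φ : E → X}

/-- The induced bijective isometry of `E` is affine by Mazur–Ulam. -/
lemma IsGeometricAction.exists_affine (hG : IsGeometricAction G X) (hφ : Isometry φ) {h : G}
    (hh : h ∈ MulAction.stabilizer G (Set.range φ)) :
    ∃ (L : E →L[ℝ] E) (v : E), (∀ x, h • φ x = φ (L x + v)) ∧ ∀ x, ‖L x‖ = ‖x‖ := by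
  have hex : ∀ h ∈ MulAction.stabilizer G (Set.range φ), ∀ x, ∃ y, φ y = h • φ x := by
    intro h hh x
    have : h • φ x ∈ h • Set.range φ := Set.smul_mem_smul_set ⟨x, rfl⟩
    rwa [MulAction.mem_stabilizer_iff.1 hh] at this
  choose e he using hex h hh
  choose e' he' using hex h⁻¹ (inv_mem hh)
  let F : E ≃ᵢ E := IsometryEquiv.mk' e e' (fun x => hφ.injective (by rw [he, he', smul_inv_smul]))
    (Isometry.of_dist_eq fun x y => by
      rw [← hφ.dist_eq, he, he, hG.dist_smul, hφ.dist_eq])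
  refine ⟨F.toRealLinearIsometryEquiv.toContinuousLinearEquiv.toContinuousLinearMap, F 0,
    fun x => ?_, fun x => F.toRealLinearIsometryEquiv.norm_map x⟩
  have : F.toRealLinearIsometryEquiv x = F x - F 0 := F.toRealLinearIsometryEquiv_apply x
  rw [← he]
  change φ (F x) = φ (F.toRealLinearIsometryEquiv x + F 0)
  rw [this, sub_add_cancel]

/-- The elements of `G` which act on the image of `φ` as translations. -/
def translationSubgroup (G : Type w) [Group G] [MulAction G X] (φ : E → X) : Subgroup G where
  carrier := {g | ∃ v, ∀ x, g • φ x = φ (x + v)}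
  one_mem' := ⟨0, fun x => by simp⟩
  mul_mem' := by
    rintro g h ⟨v, hv⟩ ⟨w, hw⟩
    exact ⟨w + v, fun x => by rw [mul_smul, hw, hv, add_assoc]⟩
  inv_mem' := by
    rintro g ⟨v, hv⟩
    exact ⟨-v, fun x => by rw [inv_smul_eq_iff, hv, neg_add_cancel_right]⟩

/-- The stabilizer acts on `E` by affine isometries, discretely by proper discontinuity, so
Bieberbach's theorem applies. -/
lemma IsGeometricAction.exists_translation_near (hG : IsGeometricAction G X) [ProperSpace X]
    [FiniteDimensional ℝ E] (hφ : Isometry φ) {R : ℝ}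
    (hR : ∀ x, ∃ h ∈ MulAction.stabilizer G (Set.range φ), dist (h • φ 0) (φ x) ≤ R) :
    ∃ R' : ℝ, ∀ x, ∃ (t : G) (v : E), (∀ z, t • φ z = φ (z + v)) ∧ ‖v - x‖ ≤ R' := by
  choose L b hLb hL using fun h : MulAction.stabilizer G (Set.range φ) => hG.exists_affine hφ h.2
  have hmul : ∀ g h x, L (g * h) x + b (g * h) = L g (L h x + b h) + b g := by
    intro g h x
    apply hφ.injective
    rw [← hLb, ← hLb, ← hLb, ← mul_smul]; rfl
  have hone : ∀ x, L 1 x + b 1 = x := by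
    intro x
    apply hφ.injective
    rw [← hLb]; simp
  have hbmul : ∀ g h, b (g * h) = L g (b h) + b g := by
    intro g h
    simpa using hmul g h 0
  have hb1 : b 1 = 0 := by simpa using hone 0
  let A : MulAction.stabilizer G (Set.range φ) →* (E →L[ℝ] E) :=
    { toFun := L
      map_one' := by
        ext x
        have := hone x
        rwa [hb1, add_zero] at this
      map_mul' := by
        intro g h
        ext x
        have := hmul g h x
        rw [hbmul, map_add, add_assoc] at this
        exact add_right_cancel this }
  have hA : IsIsometricAffine A b := ⟨hL, hbmul⟩
  have hb : ∀ h : MulAction.stabilizer G (Set.range φ), (h : G) • φ 0 = φ (b h) := by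
    intro h
    rw [hLb, map_zero, zero_add]
  have hfin : {h | ‖b h‖ ≤ 1}.Finite := by
    refine ((hG.finite_setOf_dist_le (φ 0) (φ 0) 1).preimage
      Subtype.val_injective.injOn).subset fun h hh => ?_
    change dist ((h : G) • φ 0) (φ 0) ≤ 1
    rw [hb, hφ.dist_eq, dist_zero_right]
    exact hh
  obtain ⟨R', hR'⟩ := hA.exists_translation_near hfin (R := R) (by
    intro x
    obtain ⟨h, hh, hd⟩ := hR x
    refine ⟨⟨h, hh⟩, ?_⟩
    rwa [← dist_eq_norm, ← hφ.dist_eq, ← hb])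
  refine ⟨R', fun x => ?_⟩
  obtain ⟨h, hh1, hh2⟩ := hR' x
  refine ⟨h, b h, fun z => ?_, hh2⟩
  rw [hLb, show L h = 1 from hh1, one_apply_eq_self]

/-- A long translation is shortened by splitting off one close to a multiple of it, leaving a
remainder of norm at most `2 * R + 1`. -/
lemma closure_eq_translationSubgroup (hφ : Isometry φ) {R : ℝ}
    (hR : ∀ x, ∃ (t : G) (v : E), (∀ z, t • φ z = φ (z + v)) ∧ ‖v - x‖ ≤ R) :
    Subgroup.closure {t | t ∈ translationSubgroup G φ ∧ dist (t • φ 0) (φ 0) ≤ 2 * R + 1} =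
      translationSubgroup G φ := by
  set S := {t | t ∈ translationSubgroup G φ ∧ dist (t • φ 0) (φ 0) ≤ 2 * R + 1} with hS
  have hR0 : 0 ≤ R := by
    obtain ⟨_, _, -, h⟩ := hR 0
    exact (norm_nonneg _).trans h
  refine le_antisymm ((Subgroup.closure_le _).2 fun t ht => ht.1) ?_
  have hS' : ∀ (t : G) (v : E), (∀ z, t • φ z = φ (z + v)) → ‖v‖ ≤ 2 * R + 1 →
      t ∈ Subgroup.closure S := by
    intro t v htv hv
    refine Subgroup.subset_closure ⟨⟨v, htv⟩, ?_⟩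
    rwa [htv, hφ.dist_eq, zero_add, dist_zero_right]
  have key : ∀ n : ℕ, ∀ (t : G) (v : E), (∀ z, t • φ z = φ (z + v)) → ‖v‖ ≤ R + n →
      t ∈ Subgroup.closure S := by
    intro n
    induction n with
    | zero =>
      intro t v htv hv
      refine hS' t v htv ?_
      push_cast at hv
      linarith
    | succ n ih =>
      intro t v htv hv
      push_cast at hv
      -- Chosen so that `‖v‖ ≤ R + n + 1` yields both `‖r • v‖ ≤ n` and `‖v - r • v‖ ≤ R + 1`.
      set r : ℝ := n / (n + R + 1) with hr
      have hden : 0 < (n : ℝ) + R + 1 := by positivity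
      have hr0 : 0 ≤ r := by positivity
      have hr1 : 1 - r = (R + 1) / (n + R + 1) := by rw [hr]; field_simp; ring
      obtain ⟨t', v', ht', hv'⟩ := hR (r • v)
      have e1 : ‖r • v‖ ≤ n := by
        rw [norm_smul, Real.norm_of_nonneg hr0, hr, div_mul_eq_mul_div, div_le_iff₀ hden]
        gcongr
        linarith
      have e2 : ‖v - r • v‖ ≤ R + 1 := by
        have : v - r • v = (1 - r) • v := by rw [sub_smul, one_smul]
        rw [this, hr1, norm_smul, Real.norm_of_nonneg (by positivity), div_mul_eq_mul_div,
          div_le_iff₀ hden]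
        gcongr
        linarith
      have h1 : t' ∈ Subgroup.closure S := by
        refine ih t' v' ht' ?_
        have := norm_add_le (v' - r • v) (r • v)
        rw [sub_add_cancel] at this
        linarith
      have h2 : t'⁻¹ * t ∈ Subgroup.closure S := by
        refine hS' _ (v - v') (fun z => ?_) ?_
        · rw [mul_smul, htv, inv_smul_eq_iff, ht']
          congr 1; abel
        · have := norm_sub_le (v - r • v) (v' - r • v)
          rw [sub_sub_sub_cancel_right] at this
          linarith
      have := mul_mem h1 h2
      rwa [mul_inv_cancel_left] at this
  rintro t ⟨v, hv⟩
  obtain ⟨n, hn⟩ := exists_nat_ge ‖v‖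
  exact key n t v hv (by linarith)

end FlatStabilizers

/-! ### Images of geodesics in and near flats. -/

section FlatsMapToGeodesics

open scoped Pointwise

variable {G : Type w} {X : Type u} {Y : Type v} [Group G] [MetricSpace X] [MetricSpace Y]
  [MulAction G X] [MulAction G Y]

lemma IsQIEmbedding.dist_le_of_le {lam eps r : ℝ} (hlam : 1 ≤ lam) {f : X → Y}
    (hf : IsQIEmbedding lam eps f) {x y : X} (h : dist x y ≤ r) :
    dist (f x) (f y) ≤ lam * r + eps := by
  have := (hf x y).2
  nlinarith

/-- An equivariant quasi-isometric embedding almost maps midpoints in a periodic flat to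
midpoints. -/
lemma exists_midpoint_constant (hX : IsGeometricAction G X) (hY : IsGeometricAction G Y)
    (hYcat : IsCAT0 Y) [ProperSpace X] [ProperSpace Y] {f : X → Y} {lam eps : ℝ} (hlam : 1 ≤ lam)
    (hf : IsQIEmbedding lam eps f) (hequiv : ∀ (g : G) (x : X), f (g • x) = g • f x)
    {E : Type*} [NormedAddCommGroup E] [NormedSpace ℝ E] {φ : E → X} (hφ : Isometry φ) {R : ℝ}
    (hR : ∀ x, ∃ (t : G) (v : E), (∀ z, t • φ z = φ (z + v)) ∧ ‖v - x‖ ≤ R) :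
    ∃ C : ℝ, ∀ (x z : E) (c : ℝ → Y), IsLinearGeodesic c → c 0 = f (φ x) → c 1 = f (φ z) →
      dist (f (φ ((1 / 2 : ℝ) • (x + z)))) (c (1 / 2)) ≤ C := by
  have hne : Nonempty Y := ⟨f (φ 0)⟩
  have hfinS : {t | t ∈ translationSubgroup G φ ∧
      dist (t • φ 0) (φ 0) ≤ 2 * R + 1}.Finite :=
    (hX.finite_setOf_dist_le (φ 0) (φ 0) (2 * R + 1)).subset fun t ht => ht.2
  obtain ⟨y, hy⟩ := hY.exists_dist_sq_eq hYcat (translationSubgroup G φ) hfinS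
    (closure_eq_translationSubgroup hφ hR) (by
      rintro a ⟨v, hv⟩
      -- Translations commute on the flat, so all conjugates of `a` send `φ 0` to `a • φ 0`; proper
      -- discontinuity leaves finitely many.
      refine (hX.finite_setOf_dist_le (φ 0) (a • φ 0) 0).subset ?_
      rintro _ ⟨t, ⟨w, hw⟩, rfl⟩
      refine le_of_eq (dist_eq_zero.2 ?_)
      have hw' : t⁻¹ • φ 0 = φ (0 - w) := by
        rw [inv_smul_eq_iff, hw, sub_add_cancel]
      rw [mul_smul, mul_smul, hw', hv, hw, hv]
      congr 1; abel)
  set C₀ := dist (f (φ 0)) y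
  have near : ∀ (t : G) (v : E), (∀ z, t • φ z = φ (z + v)) → ∀ x : E,
      dist (f (φ x)) (t • y) ≤ lam * ‖v - x‖ + eps + C₀ := by
    intro t v ht x
    have h1 : dist (f (φ x)) (f (φ v)) ≤ lam * ‖v - x‖ + eps := by
      refine hf.dist_le_of_le hlam ?_
      rw [hφ.dist_eq, dist_comm, dist_eq_norm]
    have h2 : dist (f (φ v)) (t • y) = C₀ := by
      rw [← zero_add v, ← ht, hequiv, hY.dist_smul]
    linarith [dist_triangle (f (φ x)) (f (φ v)) (t • y)]
  refine ⟨(lam * R + eps + C₀) + (lam * (3 * R) + eps + C₀), fun x z c hc hc0 hc1 => ?_⟩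
  set m := (1 / 2 : ℝ) • (x + z) with hm
  -- With `t` near `x` and `s = t * e` near the midpoint `m`, the element `s * e` is near `z = 2 m -
  -- x`, with error at most `2 * R + R`. The choice of `y` makes `s • y` the midpoint of `t • y` and
  -- `(s * e) • y`.
  obtain ⟨t, v, htv, hv⟩ := hR x
  obtain ⟨s, w, hsw, hw⟩ := hR m
  have hinv : ∀ q, t⁻¹ • φ q = φ (q - v) := fun q => by
    rw [inv_smul_eq_iff, htv, sub_add_cancel]
  set e := t⁻¹ * s with he
  have heT : e ∈ translationSubgroup G φ :=
    ⟨w - v, fun q => by rw [he, mul_smul, hsw, hinv, add_sub_assoc]⟩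
  have hte : t * e = s := by rw [he, mul_inv_cancel_left]
  have hse : ∀ q, (s * e) • φ q = φ (q + (2 • w - v)) := fun q => by
    rw [he, mul_smul, mul_smul, hsw, hinv, hsw]
    congr 1; rw [two_smul]; abel
  obtain ⟨d, hd, hd0, hd1⟩ := hYcat.exists_isLinearGeodesic (t • y) ((s * e) • y)
  have hdist : dist (t • y) ((s * e) • y) = 2 * dist y (e • y) := by
    rw [← hte, mul_smul, mul_smul, hY.dist_smul]
    exact hy e heT
  have hR0 : 0 ≤ R := (norm_nonneg _).trans hv
  have hdm : d (1 / 2) = s • y := by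
    apply hYcat.eq_half hd
    · rw [hd0, hd1, hdist, ← hte, mul_smul, hY.dist_smul]; ring
    · rw [hd0, hd1, hdist, mul_smul, hY.dist_smul]; ring
  have h0 : dist (c 0) (d 0) ≤ lam * (3 * R) + eps + C₀ := by
    rw [hc0, hd0]
    refine (near t v htv x).trans ?_
    have : lam * ‖v - x‖ ≤ lam * (3 * R) := by gcongr; linarith
    linarith
  have h1 : dist (c 1) (d 1) ≤ lam * (3 * R) + eps + C₀ := by
    rw [hc1, hd1]
    refine (near (s * e) _ hse z).trans ?_
    have hz : (2 • w - v) - z = (2 : ℝ) • (w - m) - (v - x) := by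
      rw [hm, smul_sub, smul_smul, two_smul, two_smul]
      norm_num; abel
    have h2 : ‖(2 • w - v) - z‖ ≤ 3 * R := by
      rw [hz]
      refine (norm_sub_le _ _).trans ?_
      rw [norm_smul]
      norm_num
      linarith
    have : lam * ‖(2 • w - v) - z‖ ≤ lam * (3 * R) := by gcongr
    linarith
  have h2 := hYcat.dist_le_of_le hc hd h0 h1 (θ := 1 / 2) ⟨by norm_num, by norm_num⟩
  have h3 : dist (f (φ m)) (s • y) ≤ lam * R + eps + C₀ := by
    refine (near s w hsw m).trans ?_
    have : lam * ‖w - m‖ ≤ lam * R := by gcongr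
    linarith
  rw [hdm] at h2
  linarith [dist_triangle_right (f (φ m)) (c (1 / 2)) (s • y)]

/-- A coarsely bounded map which almost preserves midpoints is uniformly close to geodesics. -/
lemma IsCAT0.dist_lineMap_le (hY : IsCAT0 Y) {E : Type*} [NormedAddCommGroup E]
    [NormedSpace ℝ E] {f : E → Y} {C : ℝ}
    (hC : ∀ (x z : E) (c : ℝ → Y), IsLinearGeodesic c → c 0 = f x → c 1 = f z →
      dist (f ((1 / 2 : ℝ) • (x + z))) (c (1 / 2)) ≤ C)
    {lam eps : ℝ} (hlam : 0 ≤ lam) (hf : ∀ x z, dist (f x) (f z) ≤ lam * dist x z + eps)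
    {x z : E} {c : ℝ → Y} (hc : IsLinearGeodesic c) (hc0 : c 0 = f x) (hc1 : c 1 = f z)
    {θ : ℝ} (hθ : θ ∈ Set.Icc (0 : ℝ) 1) :
    dist (f (AffineMap.lineMap x z θ)) (c θ) ≤ 2 * C := by
  set u : ℝ → ℝ := fun θ => dist (f (AffineMap.lineMap x z θ)) (c θ) with hu
  have hbdd : BddAbove (u '' Set.Icc (0 : ℝ) 1) := by
    refine ⟨lam * dist x z + eps + dist (f x) (f z), ?_⟩
    rintro _ ⟨s, hs, rfl⟩
    have h1 := hf (AffineMap.lineMap x z s) x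
    rw [dist_lineMap_left, Real.norm_of_nonneg hs.1] at h1
    have h2 := hc 0 (by simp) s hs
    rw [hc0, hc1, zero_sub, abs_neg, abs_of_nonneg hs.1] at h2
    have h3 : s * dist x z ≤ dist x z := mul_le_of_le_one_left dist_nonneg hs.2
    have h4 : s * dist (f x) (f z) ≤ dist (f x) (f z) := mul_le_of_le_one_left dist_nonneg hs.2
    have h5 : lam * (s * dist x z) ≤ lam * dist x z := by gcongr
    have := dist_triangle (f (AffineMap.lineMap x z s)) (f x) (c s)
    simp only [hu]
    linarith
  set M := sSup (u '' Set.Icc (0 : ℝ) 1) with hM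
  have hle : ∀ s ∈ Set.Icc (0 : ℝ) 1, u s ≤ M := fun s hs => le_csSup hbdd ⟨s, hs, rfl⟩
  -- The point at `s` is the midpoint of the start and the point at `2 * s`. Almost preserving
  -- midpoints costs `C`, and convexity halves the error at `2 * s`; hence `M ≤ M / 2 + C`, where
  -- finiteness of `M` matters.
  have half : ∀ (x z : E) (c : ℝ → Y), IsLinearGeodesic c → c 0 = f x → c 1 = f z →
      (∀ s ∈ Set.Icc (0 : ℝ) 1, dist (f (AffineMap.lineMap x z s)) (c s) ≤ M) →
      ∀ s ∈ Set.Icc (0 : ℝ) (1 / 2), dist (f (AffineMap.lineMap x z s)) (c s) ≤ M / 2 + C := by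
    intro x z c hc hc0 hc1 hle s hs
    have h2s : 2 * s ∈ Set.Icc (0 : ℝ) 1 := ⟨by linarith [hs.1], by linarith [hs.2]⟩
    obtain ⟨d, hd, hd0, hd1⟩ := hY.exists_isLinearGeodesic (f x) (f (AffineMap.lineMap x z (2 * s)))
    have h1 := hC x _ d hd hd0 hd1
    have hmid : (1 / 2 : ℝ) • (x + AffineMap.lineMap x z (2 * s)) = AffineMap.lineMap x z s := by
      simp only [AffineMap.lineMap_apply_module]
      module
    rw [hmid] at h1
    have hc' := hc.comp_affine (a := 0) (b := 2 * s) (by simp) h2s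
    have h2 := hY.dist_le_of_start_eq hd hc' (by simp [hd0, hc0]) (θ := 1 / 2)
      ⟨by norm_num, by norm_num⟩
    have e1 : (0 : ℝ) + 1 / 2 * (2 * s - 0) = s := by ring
    have e2 : (0 : ℝ) + 1 * (2 * s - 0) = 2 * s := by ring
    simp only [e1, e2, hd1] at h2
    have h3 := hle (2 * s) h2s
    linarith [dist_triangle (f (AffineMap.lineMap x z s)) (d (1 / 2)) (c s)]
  have hall : ∀ s ∈ Set.Icc (0 : ℝ) 1, u s ≤ M / 2 + C := by
    intro s hs
    rcases le_total s (1 / 2) with h | h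
    · exact half x z c hc hc0 hc1 hle s ⟨hs.1, h⟩
    · have := half z x (fun s => c (1 - s)) hc.symm (by simp [hc1]) (by simp [hc0])
        (fun s hs => by
          have := hle (1 - s) ⟨by linarith [hs.2], by linarith [hs.1]⟩
          simpa only [hu, AffineMap.lineMap_apply_one_sub] using this)
        (1 - s) ⟨by linarith [hs.2], by linarith⟩
      simpa only [hu, AffineMap.lineMap_apply_one_sub, sub_sub_cancel] using this
  have hMle : M ≤ M / 2 + C := by
    refine csSup_le ⟨u 0, 0, by simp, rfl⟩ ?_
    rintro _ ⟨s, hs, rfl⟩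
    exact hall s hs
  have := hall θ hθ
  simp only [hu] at this
  linarith

/-- Geodesics joining points of `F` are mapped by `f` to within `C` of geodesics. -/
def MapsGeodesicsNear (f : X → Y) (C : ℝ) (F : Set X) : Prop :=
  ∀ p ∈ F, ∀ q ∈ F, ∃ σ : ℝ → X, IsLinearGeodesic σ ∧ σ 0 = p ∧ σ 1 = q ∧
    ∀ c : ℝ → Y, IsLinearGeodesic c → c 0 = f p → c 1 = f q →
      ∀ θ ∈ Set.Icc (0 : ℝ) 1, dist (f (σ θ)) (c θ) ≤ C

lemma MapsGeodesicsNear.smul (hX : IsGeometricAction G X) (hY : IsGeometricAction G Y) {f : X → Y}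
    (hequiv : ∀ (g : G) (x : X), f (g • x) = g • f x) {C : ℝ} {F : Set X}
    (h : MapsGeodesicsNear f C F) (g : G) : MapsGeodesicsNear f C (g • F) := by
  rintro _ ⟨p, hp, rfl⟩ _ ⟨q, hq, rfl⟩
  obtain ⟨σ, hσ, h0, h1, hσc⟩ := h p hp q hq
  refine ⟨fun s => g • σ s, hσ.comp_isometry (hX.isometric.isometry_smul g), by simp [h0],
    by simp [h1], fun c hc hc0 hc1 θ hθ => ?_⟩
  have := hσc (fun s => g⁻¹ • c s) (hc.comp_isometry (hY.isometric.isometry_smul g⁻¹))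
    (by simp [hc0, hequiv]) (by simp [hc1, hequiv]) θ hθ
  rw [← hY.dist_smul g, smul_inv_smul] at this
  simpa only [hequiv] using this

/-- Equivariant quasi-isometric embeddings map geodesics in members of an isolated invariant
family of flats uniformly close to geodesics. -/
lemma exists_mapsGeodesicsNear (hX : IsGeometricAction G X) (hY : IsGeometricAction G Y)
    (hYcat : IsCAT0 Y) [ProperSpace X] [ProperSpace Y] {f : X → Y} {lam eps : ℝ} (hlam : 1 ≤ lam)
    (hf : IsQIEmbedding lam eps f) (hequiv : ∀ (g : G) (x : X), f (g • x) = g • f x)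
    {𝓕 : Set (Set X)} (hflat : ∀ F ∈ 𝓕, IsFlat F) {r : ℝ≥0}
    (hψ : ∀ F₁ ∈ 𝓕, ∀ F₂ ∈ 𝓕, F₁ ≠ F₂ →
      Metric.ediam (Metric.cthickening 1 F₁ ∩ Metric.cthickening 1 F₂) ≤ r)
    (hinv : ∀ g : G, ∀ F ∈ 𝓕, g • F ∈ 𝓕) :
    ∃ C : ℝ, ∀ F ∈ 𝓕, MapsGeodesicsNear f C F := by
  obtain ⟨K, hK, hcov⟩ := hX.cocompact
  have hlf := finite_setOf_flats_meeting hflat hψ hK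
  have hone : ∀ F ∈ 𝓕, ∃ C, MapsGeodesicsNear f C F := by
    intro F hF
    obtain ⟨k, hk, φ, hφ, hφF⟩ := hflat F hF
    obtain ⟨R, hR⟩ := hX.exists_stabilizer_near hK hcov hinv hlf hF (φ 0)
    subst hφF
    obtain ⟨R', hR'⟩ := hX.exists_translation_near hφ fun x => hR (φ x) ⟨x, rfl⟩
    obtain ⟨C, hC⟩ := exists_midpoint_constant hX hY hYcat hlam hf hequiv hφ hR'
    refine ⟨2 * C, ?_⟩
    rintro _ ⟨x, rfl⟩ _ ⟨z, rfl⟩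
    have hlin : IsLinearGeodesic fun θ : ℝ => φ (AffineMap.lineMap x z θ) := by
      intro s _ t _
      simp only [hφ.dist_eq, dist_lineMap_lineMap, Real.dist_eq, AffineMap.lineMap_apply_zero,
        AffineMap.lineMap_apply_one]
    refine ⟨fun θ => φ (AffineMap.lineMap x z θ), hlin, by simp, by simp,
      fun c hc hc0 hc1 θ hθ => ?_⟩
    refine hYcat.dist_lineMap_le (f := fun x => f (φ x)) hC (zero_le_one.trans hlam) (eps := eps)
      (fun x z => ?_) hc hc0 hc1 hθ
    rw [← hφ.dist_eq]
    exact (hf _ _).2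
  choose! C hC using hone
  -- Every flat of the family has a translate meeting `K`, and only finitely many members meet `K`.
  obtain ⟨M, hM⟩ := (hlf.image C).bddAbove
  refine ⟨M, fun F hF => ?_⟩
  obtain ⟨k, hk, φ, hφ, hφF⟩ := hflat F hF
  obtain ⟨g, p, hp, hgp⟩ := exists_smul_mem_of_iUnion_eq hcov (φ 0)
  have hmem : g⁻¹ • F ∈ {F ∈ 𝓕 | (F ∩ K).Nonempty} := by
    refine ⟨hinv _ _ hF, p, Set.mem_inv_smul_set_iff.2 ?_, hp⟩
    rw [hgp, ← hφF]
    exact ⟨0, rfl⟩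
  have h1 := (hC _ hmem.1).smul hX hY hequiv g
  rw [smul_inv_smul] at h1
  intro p hp q hq
  obtain ⟨σ, hσ, h0, h1, hσc⟩ := h1 p hp q hq
  exact ⟨σ, hσ, h0, h1, fun c hc hc0 hc1 θ hθ =>
    (hσc c hc hc0 hc1 θ hθ).trans (hM ⟨_, hmem, rfl⟩)⟩

/-- Equivariant quasi-isometric embeddings of a space with isolated flats map geodesics near flats
uniformly close to geodesics. -/
lemma exists_near_flat_constant (hXcat : IsCAT0 X) (hX : IsGeometricAction G X)
    (hY : IsGeometricAction G Y) (hYcat : IsCAT0 Y) [ProperSpace X] [ProperSpace Y] {f : X → Y}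
    {lam eps : ℝ} (hlam : 1 ≤ lam) (hf : IsQIEmbedding lam eps f)
    (hequiv : ∀ (g : G) (x : X), f (g • x) = g • f x) (hflats : HasIsolatedFlats X) (L : ℝ≥0) :
    ∃ C : ℝ, ∀ F : Set X, IsFlat F → ∀ σ : ℝ → X, IsLinearGeodesic σ →
      σ 0 ∈ Metric.cthickening L F → σ 1 ∈ Metric.cthickening L F →
      ∀ c : ℝ → Y, IsLinearGeodesic c → c 0 = f (σ 0) → c 1 = f (σ 1) →
      ∀ θ ∈ Set.Icc (0 : ℝ) 1, dist (f (σ θ)) (c θ) ≤ C := by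
  obtain ⟨𝓕, hflat, ⟨B, hB⟩, ⟨ψ, hψ⟩, hinv⟩ := hflats
  have := hX.isometric
  obtain ⟨C, hC⟩ := exists_mapsGeodesicsNear hX hY hYcat hlam hf hequiv hflat (r := ψ 1)
    (fun F₁ h₁ F₂ h₂ hne => by simpa using hψ F₁ h₁ F₂ h₂ hne 1)
    (fun g F hF => hinv (IsometryEquiv.constSMul g) F hF)
  set r : ℝ := (L + 1) + (B + 1) with hr
  refine ⟨2 * (lam * r + eps) + C, fun F hF σ hσ h0 h1 c hc hc0 hc1 θ hθ => ?_⟩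
  obtain ⟨F', hF', hFF'⟩ := hB F hF
  have hnear : ∀ x ∈ Metric.cthickening L F, ∃ p ∈ F', dist x p ≤ r := by
    intro x hx
    obtain ⟨q, hq, hxq⟩ := exists_dist_le_of_mem_cthickening hx
    obtain ⟨p, hp, hqp⟩ := exists_dist_le_of_mem_cthickening (hFF' hq)
    exact ⟨p, hp, by linarith [dist_triangle x q p]⟩
  obtain ⟨p, hp, hp0⟩ := hnear _ h0
  obtain ⟨q, hq, hq1⟩ := hnear _ h1
  obtain ⟨τ, hτ, hτ0, hτ1, hτc⟩ := hC F' hF' p hp q hq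
  obtain ⟨d, hd, hd0, hd1⟩ := hYcat.exists_isLinearGeodesic (f p) (f q)
  have e1 := hf.dist_le_of_le hlam
    (hXcat.dist_le_of_le hσ hτ (hτ0 ▸ hp0) (hτ1 ▸ hq1) hθ)
  have e2 := hτc d hd hd0 hd1 θ hθ
  have e3 := hYcat.dist_le_of_le hc hd (C := lam * r + eps)
    (by rw [hc0, hd0]; exact hf.dist_le_of_le hlam hp0)
    (by rw [hc1, hd1]; exact hf.dist_le_of_le hlam hq1) hθ
  rw [dist_comm] at e3
  linarith [dist_triangle4 (f (σ θ)) (f (τ θ)) (d θ) (c θ)]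

end FlatsMapToGeodesics

/-! ### Geodesic segments map close to geodesic segments. -/

section Segments

namespace IsPartition

variable {n : ℕ} {a : ℝ} {t s : ℕ → ℝ}

lemma nonneg (h : IsPartition n a t s) : ∀ i ≤ n, 0 ≤ t i := by
  intro i
  induction i with
  | zero => intro _; exact h.left.ge
  | succ i ih =>
    intro hi
    exact (ih (by omega)).trans ((h.le i (by omega)).trans (h.le_next i (by omega)))

lemma le_right (h : IsPartition n a t s) : ∀ i ≤ n, s i ≤ a := by
  intro i hi
  induction hi using Nat.decreasingInduction with
  | self => exact h.right.le
  | of_succ i hi ih => exact (h.le_next i hi).trans ((h.le (i + 1) hi).trans ih)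

lemma cover (h : IsPartition n a t s) {x : ℝ} (h0 : 0 ≤ x) (hx : x ≤ a) :
    (∃ i ≤ n, x ∈ Set.Icc (t i) (s i)) ∨ ∃ i < n, x ∈ Set.Icc (s i) (t (i + 1)) := by
  have key : ∀ m ≤ n, x ≤ s m →
      (∃ i ≤ n, x ∈ Set.Icc (t i) (s i)) ∨ ∃ i < n, x ∈ Set.Icc (s i) (t (i + 1)) := by
    intro m
    induction m with
    | zero => exact fun hm hx => Or.inl ⟨0, hm, h.left.le.trans h0, hx⟩
    | succ m ih =>
      intro hm hx
      rcases le_total (t (m + 1)) x with h1 | h1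
      · exact Or.inl ⟨m + 1, hm, h1, hx⟩
      · rcases le_total (s m) x with h2 | h2
        · exact Or.inr ⟨m, hm, h2, h1⟩
        · exact ih (by omega) h2
  exact key n le_rfl (hx.trans h.right.ge)

end IsPartition

variable {X : Type u} {Y : Type v} [MetricSpace X] [MetricSpace Y]

lemma IsQIEmbedding.dist_le_of_dist_map_le {lam eps r : ℝ} (hlam : 1 ≤ lam) {f : X → Y}
    (hf : IsQIEmbedding lam eps f) {x y : X} (h : dist (f x) (f y) ≤ r) :
    dist x y ≤ lam * (r + eps) := by
  have h1 := (hf x y).1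
  have h2 : lam⁻¹ * dist x y ≤ r + eps := by linarith
  rwa [inv_mul_le_iff₀ (by linarith)] at h2

lemma IsGeodesic.isQuasigeodesic {lam eps a : ℝ} (hlam : 1 ≤ lam) (heps : 0 ≤ eps) {c : ℝ → X}
    (hc : IsGeodesic (Set.Icc 0 a) c) : IsQuasigeodesic lam eps a c := by
  rintro ⟨s, hs⟩ ⟨t, ht⟩
  simp only [Set.domRestrict_apply]
  rw [hc.dist_eq hs ht, Subtype.dist_eq, Real.dist_eq]
  have h1 := abs_nonneg (s - t)
  have h2 : lam⁻¹ ≤ 1 := inv_le_one_of_one_le₀ hlam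
  constructor <;> nlinarith

/-- A lift of a geodesic of the target along a quasi-isometry is a quasigeodesic. -/
lemma IsQIEmbedding.isQuasigeodesic_lift {lam eps a : ℝ} (hlam : 1 ≤ lam) (heps : 0 ≤ eps)
    {f : X → Y} (hf : IsQIEmbedding lam eps f) (ha : 0 ≤ a) {γ : ℝ → Y}
    (hγ : IsGeodesic (Set.Icc 0 a) γ) {β : ℝ → X}
    (hβ : ∀ t ∈ Set.Icc 0 (a + 1), dist (f (β t)) (γ (min t a)) ≤ eps) :
    IsQuasigeodesic lam (lam * (3 * eps + 1)) (a + 1) β := by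
  rintro ⟨s, hs⟩ ⟨t, ht⟩
  simp only [Set.domRestrict_apply]
  rw [Subtype.dist_eq, Real.dist_eq]
  have hmem : ∀ t ∈ Set.Icc 0 (a + 1), min t a ∈ Set.Icc 0 a :=
    fun t ht => ⟨le_min ht.1 ha, min_le_right _ _⟩
  have hdist := hγ.dist_eq (hmem s hs) (hmem t ht)
  -- Stopping the parameter at `a` changes distances by at most 1, which accounts for the `1` in `3
  -- * eps + 1`.
  have hmin : |min s a - min t a| ≤ |s - t| ∧ |s - t| ≤ |min s a - min t a| + 1 := by
    rcases min_cases s a with h | h <;> rcases min_cases t a with h' | h' <;>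
      rw [h.1, h'.1] <;> constructor <;> cases abs_cases (s - t) <;>
      first
      | linarith [hs.2, ht.2, le_abs_self (s - a), neg_abs_le (s - a), le_abs_self (a - t),
          neg_abs_le (a - t), le_abs_self (a - a), neg_abs_le (a - a), abs_nonneg (a - a)]
      | (apply abs_le.2; constructor <;> linarith [hs.2, ht.2])
  have h1 := hβ s hs
  have h2 := hβ t ht
  have h3 := dist_triangle4 (f (β s)) (γ (min s a)) (γ (min t a)) (f (β t))
  have h4 := dist_triangle4 (γ (min s a)) (f (β s)) (f (β t)) (γ (min t a))
  rw [dist_comm (γ (min t a)) (f (β t))] at h3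
  rw [dist_comm (γ (min s a)) (f (β s))] at h4
  have h5 := (hf (β s) (β t)).2
  constructor
  · have hl : lam⁻¹ * |s - t| ≤ lam⁻¹ * (lam * dist (β s) (β t) + (3 * eps + 1)) := by
      gcongr; linarith [hmin.2]
    rw [mul_add, inv_mul_cancel_left₀ (by linarith)] at hl
    have h6 : lam⁻¹ * (3 * eps + 1) ≤ lam * (3 * eps + 1) := by
      gcongr
      exact (inv_le_one_of_one_le₀ hlam).trans hlam
    linarith
  · have := hf.dist_le_of_dist_map_le hlam (x := β s) (y := β t) (r := |s - t| + 2 * eps)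
      (by linarith [hmin.1])
    nlinarith

variable {G : Type w} [Group G] [MulAction G X] [MulAction G Y]

/-- The images of geodesic segments are uniformly close to geodesic segments. -/
theorem exists_segment_constant (hX : IsCAT0 X) (hY : IsCAT0 Y) (hGX : IsGeometricAction G X)
    (hGY : IsGeometricAction G Y) (hflats : HasIsolatedFlats X) (hrftp : HasRFTP X) {f : X → Y}
    (hf : IsQuasiIsometry f) (hequiv : ∀ (g : G) (x : X), f (g • x) = g • f x) :
    ∃ M : ℝ, 0 ≤ M ∧ ∀ (l : ℝ) (α : ℝ → X), 0 ≤ l → IsGeodesic (Set.Icc 0 l) α →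
      ∃ (l' : ℝ) (γ : ℝ → Y), IsGeodesic (Set.Icc 0 l') γ ∧
        (∀ t ∈ Set.Icc 0 l, ∃ u ∈ Set.Icc 0 l', dist (f (α t)) (γ u) ≤ M) ∧
        ∀ u ∈ Set.Icc 0 l', ∃ t ∈ Set.Icc 0 l, dist (f (α t)) (γ u) ≤ M := by
  classical
  have := hGX.properSpace hX
  have := hGY.properSpace hY
  obtain ⟨lam, eps, hlam, heps, hqi, hsurj⟩ := hf
  choose g hg using hsurj
  obtain ⟨L, hL⟩ := hrftp lam (lam * (3 * eps + 1)) hlam (by positivity)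
  obtain ⟨C, hC⟩ := exists_near_flat_constant hX hGX hGY hY hlam hqi hequiv hflats L
  set C₁ := lam * (L + 1) + eps + eps with hC₁
  have hC₁0 : 0 ≤ C₁ := by positivity
  set M := C₁ + max C 0 with hM
  have hM0 : 0 ≤ M := by positivity
  refine ⟨3 * M + lam + eps, by positivity, fun l α hl hα => ?_⟩
  obtain ⟨γ, hγ, hγ0, hγ1⟩ := hY.geodesic (f (α 0)) (f (α l))
  set l' := dist (f (α 0)) (f (α l)) with hl'
  have hl'0 : 0 ≤ l' := dist_nonneg
  have hfwd : ∀ t ∈ Set.Icc 0 l, ∃ u ∈ Set.Icc 0 l', dist (f (α t)) (γ u) ≤ M := by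
    -- The extra unit of parameter keeps the ends of the domain distinct when `l' = 0`, so that `β`
    -- can have the same endpoints as `α`.
    set β : ℝ → X := fun t =>
      if t = 0 then α 0 else if t = l' + 1 then α l else g (γ (min t l')) with hβ
    have hβ0 : β 0 = α 0 := by simp [hβ]
    have hβ1 : β (l' + 1) = α l := by
      have : l' + 1 ≠ 0 := by positivity
      simp [hβ, this]
    have hβγ : ∀ t ∈ Set.Icc 0 (l' + 1), dist (f (β t)) (γ (min t l')) ≤ eps := by
      intro t _
      by_cases h0 : t = 0
      · rw [h0, hβ0, min_eq_left hl'0, hγ0, dist_self]; exact heps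
      · by_cases h1 : t = l' + 1
        · rw [h1, hβ1, min_eq_right (by linarith), hγ1, dist_self]; exact heps
        · simp only [hβ, if_neg h0, if_neg h1]
          exact hg _
    obtain ⟨n, F, t, s, t', s', hF, hts, hts', hhaus, hflat⟩ := hL l (l' + 1) α β hl
      (by positivity) (hα.isQuasigeodesic hlam (by positivity))
      (hqi.isQuasigeodesic_lift hlam heps hl'0 hγ hβγ) hβ0.symm hβ1.symm
    have hclose : ∀ i ≤ n, ∀ x ∈ Set.Icc (t i) (s i), ∃ u ∈ Set.Icc 0 l',
        dist (f (α x)) (γ u) ≤ C₁ := by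
      intro i hi x hx
      have hlt : Metric.hausdorffEDist (α '' Set.Icc (t i) (s i)) (β '' Set.Icc (t' i) (s' i)) <
          ENNReal.ofReal (L + 1) := by
        refine (hhaus i hi).trans_lt ?_
        rw [← ENNReal.ofReal_coe_nnreal]
        exact (ENNReal.ofReal_lt_ofReal_iff (by positivity)).2 (lt_add_one _)
      obtain ⟨_, ⟨y, hy, rfl⟩, hd⟩ :=
        Metric.exists_edist_lt_of_hausdorffEDist_lt (Set.mem_image_of_mem α hx) hlt
      rw [edist_dist] at hd
      have hd := ((ENNReal.ofReal_lt_ofReal_iff (by positivity)).1 hd).le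
      have hy' : y ∈ Set.Icc 0 (l' + 1) :=
        ⟨(hts'.nonneg i hi).trans hy.1, hy.2.trans (hts'.le_right i hi)⟩
      refine ⟨min y l', ⟨le_min hy'.1 hl'0, min_le_right _ _⟩, ?_⟩
      linarith [dist_triangle (f (α x)) (f (β y)) (γ (min y l')), hβγ y hy',
        hqi.dist_le_of_le hlam hd]
    intro x hx
    rcases hts.cover hx.1 hx.2 with ⟨i, hi, hxi⟩ | ⟨i, hi, hxi⟩
    · obtain ⟨u, hu, hd⟩ := hclose i hi x hxi
      exact ⟨u, hu, hd.trans (le_add_of_nonneg_right (le_max_right _ _))⟩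
    · obtain ⟨u, hu, hdu⟩ := hclose i hi.le (s i) ⟨hts.le i hi.le, le_rfl⟩
      obtain ⟨v, hv, hdv⟩ := hclose (i + 1) hi (t (i + 1)) ⟨le_rfl, hts.le (i + 1) hi⟩
      have hst := hts.le_next i hi
      have hsI : s i ∈ Set.Icc 0 l :=
        ⟨(hts.nonneg i hi.le).trans (hts.le i hi.le), hts.le_right i hi.le⟩
      have htI : t (i + 1) ∈ Set.Icc 0 l :=
        ⟨hts.nonneg (i + 1) hi, (hts.le (i + 1) hi).trans (hts.le_right (i + 1) hi)⟩
      obtain ⟨θ, hθ, rfl⟩ : ∃ θ ∈ Set.Icc (0 : ℝ) 1, s i + θ * (t (i + 1) - s i) = x := by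
        have := hxi
        rw [← segment_eq_Icc hst, segment_eq_image'] at this
        simpa using this
      obtain ⟨c, hc, hc0, hc1⟩ := hY.exists_isLinearGeodesic (f (α (s i))) (f (α (t (i + 1))))
      have hlin := hα.isLinearGeodesic hsI htI
      have h1 := hC (F i) (hF i hi) _ hlin
        (by simpa using (hflat i hi).1 ⟨s i, ⟨le_rfl, hst⟩, rfl⟩)
        (by simpa using (hflat i hi).1 ⟨t (i + 1), ⟨hst, le_rfl⟩, rfl⟩)
        c hc (by simpa using hc0) (by simpa using hc1) θ hθ
      have h2 := hY.dist_le_of_le hc (hγ.isLinearGeodesic hu hv) (C := C₁)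
        (by simpa [hc0] using hdu) (by simpa [hc1] using hdv) hθ
      refine ⟨u + θ * (v - u), ?_, ?_⟩
      · convert convex_Icc (0 : ℝ) l' hu hv (sub_nonneg.2 hθ.2) hθ.1 (by ring) using 1
        simp only [smul_eq_mul]; ring
      · linarith [dist_triangle (f (α (s i + θ * (t (i + 1) - s i)))) (c θ)
          (γ (u + θ * (v - u))), le_max_left C 0]
  refine ⟨l', γ, hγ, fun t ht => ?_, fun u hu => ?_⟩
  · obtain ⟨u, hu, hd⟩ := hfwd t ht
    exact ⟨u, hu, by linarith⟩
  -- A coarse connectedness argument, as `f ∘ α` need not be continuous: near the supremum of `A`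
  -- there are times `t₁`, `t₂` at distance at most 1 whose images are close to `γ p` and `γ q` with
  -- `p ≤ u ≤ q`. Then `q - p ≤ 2 * M + lam + eps`.
  · set A : Set ℝ := {t | t ∈ Set.Icc 0 l ∧ ∃ p ∈ Set.Icc 0 u, dist (f (α t)) (γ p) ≤ M} with hA
    have hA0 : (0 : ℝ) ∈ A := ⟨⟨le_rfl, hl⟩, 0, ⟨le_rfl, hu.1⟩, by rw [hγ0, dist_self]; exact hM0⟩
    have hAb : BddAbove A := ⟨l, fun t ht => ht.1.2⟩
    obtain ⟨t₁, ht₁, hlt⟩ := exists_lt_of_lt_csSup ⟨0, hA0⟩ (sub_one_lt (sSup A))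
    obtain ⟨ht₁l, p, hp, hdp⟩ := ht₁
    obtain ⟨t₂, ht₂l, h12, q, hq, huq, hdq⟩ : ∃ t₂ ∈ Set.Icc 0 l, |t₁ - t₂| ≤ 1 ∧
        ∃ q ∈ Set.Icc 0 l', u ≤ q ∧ dist (f (α t₂)) (γ q) ≤ M := by
      rcases le_total l (t₁ + 1) with h | h
      · refine ⟨l, ⟨hl, le_rfl⟩, abs_le.2 ⟨by linarith, by linarith [ht₁l.2]⟩, l', ⟨hl'0, le_rfl⟩,
          hu.2, ?_⟩
        rw [hγ1, dist_self]; exact hM0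
      · have hmem : t₁ + 1 ∈ Set.Icc 0 l := ⟨by linarith [ht₁l.1], h⟩
        obtain ⟨q, hq, hdq⟩ := hfwd (t₁ + 1) hmem
        refine ⟨t₁ + 1, hmem, by simp, q, hq, ?_, hdq⟩
        by_contra hcon
        have : t₁ + 1 ∈ A := ⟨hmem, q, ⟨hq.1, (not_le.1 hcon).le⟩, hdq⟩
        linarith [le_csSup hAb this]
    refine ⟨t₁, ht₁l, ?_⟩
    have hp' : p ∈ Set.Icc 0 l' := ⟨hp.1, hp.2.trans hu.2⟩
    have h1 := hqi.dist_le_of_le hlam ((hα.dist_eq ht₁l ht₂l).trans_le h12)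
    have h2 := hγ.dist_eq hp' hq
    rw [abs_sub_comm, abs_of_nonneg (by linarith [hp.2])] at h2
    have h3 := hγ.dist_eq hp' hu
    rw [abs_sub_comm, abs_of_nonneg (by linarith [hp.2])] at h3
    have h4 := dist_triangle4 (γ p) (f (α t₁)) (f (α t₂)) (γ q)
    rw [dist_comm (γ p) (f (α t₁))] at h4
    linarith [dist_triangle (f (α t₁)) (γ p) (γ u)]

end Segments

/-! ### From segments to arbitrary geodesics. -/

section Limits

variable {Y : Type v} [MetricSpace Y]

/-- A pointwise limit of geodesics passing near a given point, over an ultrafilter. -/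
lemma exists_limit_geodesic [ProperSpace Y] {ι : Type*} (U : Ultrafilter ι) {J : ι → Set ℝ}
    {η : ι → ℝ → Y} (hη : ∀ᶠ p in (U : Filter ι), IsGeodesic (J p) (η p))
    (h0 : ∀ᶠ p in (U : Filter ι), (0 : ℝ) ∈ J p) {y : Y} {M : ℝ}
    (hy : ∀ᶠ p in (U : Filter ι), dist (η p 0) y ≤ M) :
    ∃ γ : ℝ → Y, IsGeodesic {t | ∀ᶠ p in (U : Filter ι), t ∈ J p} γ ∧
      ∀ t, (∀ᶠ p in (U : Filter ι), t ∈ J p) →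
        Filter.Tendsto (fun p => η p t) U (nhds (γ t)) := by
  have hlim : ∀ t, ∃ z, (∀ᶠ p in (U : Filter ι), t ∈ J p) →
      Filter.Tendsto (fun p => η p t) U (nhds z) := by
    intro t
    by_cases ht : ∀ᶠ p in (U : Filter ι), t ∈ J p
    · have hmem : Metric.closedBall y (|t| + M) ∈ U.map fun p => η p t := by
        change ∀ᶠ p in (U : Filter ι), η p t ∈ Metric.closedBall y (|t| + M)
        filter_upwards [hη, h0, hy, ht] with p h1 h2 h3 h4
        have h5 := h1.dist_eq h4 h2
        rw [sub_zero] at h5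
        rw [Metric.mem_closedBall]
        linarith [dist_triangle (η p t) (η p 0) y]
      obtain ⟨z, -, hz⟩ := (isCompact_closedBall y (|t| + M)).ultrafilter_le_nhds' _ hmem
      exact ⟨z, fun _ => hz⟩
    · exact ⟨y, fun h => absurd h ht⟩
  choose γ hγ using hlim
  refine ⟨γ, isGeodesic_of_dist_eq ⟨fun s hs t ht r hr => ?_⟩ fun s hs t ht => ?_, hγ⟩
  · filter_upwards [hη, hs, ht] with p h1 h2 h3 using h1.1.out h2 h3 hr
  · refine tendsto_nhds_unique ((hγ s hs).dist (hγ t ht)) (tendsto_const_nhds.congr' ?_)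
    filter_upwards [hη, hs, ht] with p h1 h2 h3 using (h1.dist_eq h2 h3).symm

variable {X : Type u} [MetricSpace X]

/-- If the images of geodesic segments are uniformly close to geodesic segments, then the images of
all geodesics are uniformly close to geodesics. -/
lemma exists_geodesic_of_segments [ProperSpace Y] {f : X → Y} {M : ℝ}
    (hM : ∀ (l : ℝ) (α : ℝ → X), 0 ≤ l → IsGeodesic (Set.Icc 0 l) α →
      ∃ (l' : ℝ) (γ : ℝ → Y), IsGeodesic (Set.Icc 0 l') γ ∧
        (∀ t ∈ Set.Icc 0 l, ∃ u ∈ Set.Icc 0 l', dist (f (α t)) (γ u) ≤ M) ∧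
        ∀ u ∈ Set.Icc 0 l', ∃ t ∈ Set.Icc 0 l, dist (f (α t)) (γ u) ≤ M)
    {I : Set ℝ} {α : ℝ → X} (hα : IsGeodesic I α) :
    ∃ (J : Set ℝ) (γ : ℝ → Y), IsGeodesic J γ ∧
      (∀ t ∈ I, ∃ u ∈ J, dist (f (α t)) (γ u) ≤ M + 3) ∧
      ∀ u ∈ J, ∃ t ∈ I, dist (f (α t)) (γ u) ≤ M + 3 := by
  rcases I.eq_empty_or_nonempty with rfl | ⟨t₀, ht₀⟩
  · exact ⟨∅, fun t => f (α t), isGeodesic_of_dist_eq Set.ordConnected_empty (by simp), by simp,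
      by simp⟩
  have hneY : Nonempty Y := ⟨f (α t₀)⟩
  have hneI : Nonempty I := ⟨⟨t₀, ht₀⟩⟩
  have hseg : ∀ p : I × I, p.1 ≤ t₀ ∧ t₀ ≤ p.2 → ∃ (J : Set ℝ) (η : ℝ → Y), IsGeodesic J η ∧
      (0 : ℝ) ∈ J ∧ dist (η 0) (f (α t₀)) ≤ M ∧
      (∀ t : ℝ, p.1 ≤ t ∧ t ≤ p.2 → ∃ u ∈ J, dist (f (α t)) (η u) ≤ M) ∧
      ∀ u ∈ J, ∃ t ∈ I, dist (f (α t)) (η u) ≤ M := by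
    rintro ⟨⟨a, ha⟩, ⟨b, hb⟩⟩ ⟨hat, htb⟩
    simp only at hat htb ⊢
    have hmem : ∀ t ∈ Set.Icc 0 (b - a), a + t ∈ I := fun t ht =>
      hα.1.out ha hb ⟨by linarith [ht.1], by linarith [ht.2]⟩
    obtain ⟨l', γ, hγ, h1, h2⟩ := hM (b - a) (fun t => α (a + t)) (by linarith)
      (isGeodesic_of_dist_eq Set.ordConnected_Icc fun s hs t ht => by
        rw [hα.dist_eq (hmem s hs) (hmem t ht)]; congr 1; ring)
    obtain ⟨u₀, hu₀, hd₀⟩ := h1 (t₀ - a) ⟨by linarith, by linarith⟩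
    rw [add_sub_cancel] at hd₀
    refine ⟨{u | u₀ + u ∈ Set.Icc 0 l'}, fun u => γ (u₀ + u),
      isGeodesic_of_dist_eq ⟨fun s hs t ht r hr => ?_⟩ fun s hs t ht => ?_, ?_, ?_, ?_, ?_⟩
    · exact ⟨hs.1.trans (by linarith [hr.1]), le_trans (by linarith [hr.2]) ht.2⟩
    · rw [hγ.dist_eq hs ht]; congr 1; ring
    · simpa using hu₀
    · simpa [dist_comm] using hd₀
    · rintro t ⟨hat, htb⟩
      obtain ⟨u, hu, hd⟩ := h1 (t - a) ⟨by linarith, by linarith⟩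
      exact ⟨u - u₀, by simpa using hu, by simpa using hd⟩
    · intro u hu
      obtain ⟨t, ht, hd⟩ := h2 _ hu
      exact ⟨a + t, hmem t ht, hd⟩
  choose! J η hJη hJ0 hη0 hfwd hbwd using hseg
  -- The segments `[a, b]` exhaust `I` along this ultrafilter, whether or not `I` contains its
  -- endpoints.
  let U : Ultrafilter (I × I) := Ultrafilter.of (Filter.atBot ×ˢ Filter.atTop)
  have hU : ∀ t ∈ I, ∀ᶠ p : I × I in (U : Filter (I × I)), p.1 ≤ t ∧ t ≤ p.2 := by
    intro t ht
    have : ∀ᶠ p : I × I in Filter.atBot ×ˢ Filter.atTop, p.1 ≤ ⟨t, ht⟩ ∧ ⟨t, ht⟩ ≤ p.2 :=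
      (Filter.eventually_le_atBot _).prod_mk (Filter.eventually_ge_atTop _)
    exact (Ultrafilter.of_le _) this
  have hU₀ := hU t₀ ht₀
  obtain ⟨γ, hγ, hlim⟩ := exists_limit_geodesic U (hU₀.mono hJη) (hU₀.mono hJ0) (hU₀.mono hη0)
  have hnear : ∀ t, (∀ᶠ p in (U : Filter (I × I)), t ∈ J p) →
      ∀ᶠ p in (U : Filter (I × I)), dist (η p t) (γ t) < 1 := fun t ht =>
    (hlim t ht).eventually (Metric.ball_mem_nhds _ one_pos)
  refine ⟨_, γ, hγ, fun s hs => ?_, fun u hu => ?_⟩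
  · have hex : ∀ p : I × I, ∃ u : ℝ, (p.1 ≤ t₀ ∧ t₀ ≤ p.2) → (p.1 ≤ s ∧ s ≤ p.2) →
        u ∈ J p ∧ dist (f (α s)) (η p u) ≤ M := by
      intro p
      by_cases h : (p.1 ≤ t₀ ∧ t₀ ≤ p.2) ∧ (p.1 ≤ s ∧ s ≤ p.2)
      · obtain ⟨u, hu⟩ := hfwd p h.1 s h.2
        exact ⟨u, fun _ _ => hu⟩
      · exact ⟨0, fun h1 h2 => absurd ⟨h1, h2⟩ h⟩
    choose v hv using hex
    set B := 2 * M + dist (f (α t₀)) (f (α s)) with hB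
    have hvB : Set.Icc (-B) B ∈ U.map v := by
      change ∀ᶠ p in (U : Filter (I × I)), v p ∈ Set.Icc (-B) B
      filter_upwards [hU₀, hU s hs] with p h1 h2
      obtain ⟨h3, h4⟩ := hv p h1 h2
      have h5 := (hJη p h1).dist_eq (hJ0 p h1) h3
      rw [zero_sub, abs_neg] at h5
      refine abs_le.1 ?_
      have := dist_triangle4 (η p 0) (f (α t₀)) (f (α s)) (η p (v p))
      linarith [hη0 p h1]
    obtain ⟨v₀, -, hv₀⟩ := isCompact_Icc.ultrafilter_le_nhds' _ hvB
    have hv₀ : ∀ᶠ p in (U : Filter (I × I)), dist (v p) v₀ < 1 :=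
      hv₀ (Metric.ball_mem_nhds _ one_pos)
    -- The limit `v₀` itself may lie outside the limit interval, so it is moved by at most 1 towards
    -- 0. Then `|v p - w| ≤ 2`, and together with the pointwise limit error 1 this gives the `3` in
    -- `M + 3`.
    obtain ⟨w, hwJ, hw⟩ : ∃ w, (∀ᶠ p in (U : Filter (I × I)), w ∈ J p) ∧ |w - v₀| ≤ 1 := by
      have hbetween : ∀ w, (∀ x, |x - v₀| < 1 → w ∈ Set.uIcc 0 x) →
          ∀ᶠ p in (U : Filter (I × I)), w ∈ J p := by
        intro w hw
        filter_upwards [hU₀, hU s hs, hv₀] with p h1 h2 h3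
        exact (hJη p h1).1.uIcc_subset (hJ0 p h1) (hv p h1 h2).1 (hw _ h3)
      rcases lt_or_ge 1 v₀ with h | h
      · refine ⟨v₀ - 1, hbetween _ fun x hx => ?_, by simp⟩
        rw [abs_lt] at hx
        exact Set.mem_uIcc.2 (Or.inl ⟨by linarith, by linarith⟩)
      rcases lt_or_ge v₀ (-1) with h' | h'
      · refine ⟨v₀ + 1, hbetween _ fun x hx => ?_, by simp⟩
        rw [abs_lt] at hx
        exact Set.mem_uIcc.2 (Or.inr ⟨by linarith, by linarith⟩)
      · exact ⟨0, hU₀.mono hJ0, abs_le.2 ⟨by linarith, by linarith⟩⟩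
    refine ⟨w, hwJ, ?_⟩
    obtain ⟨p, h1, h2, h3, h4, h5⟩ :=
      (hU₀.and ((hU s hs).and (hv₀.and (hwJ.and (hnear w hwJ))))).exists
    obtain ⟨h6, h7⟩ := hv p h1 h2
    have h8 := (hJη p h1).dist_eq h6 h4
    have h9 : |v p - w| ≤ 2 := by
      rw [Real.dist_eq, abs_lt] at h3
      rw [abs_le] at hw ⊢
      constructor <;> linarith
    linarith [dist_triangle4 (f (α s)) (η p (v p)) (η p w) (γ w)]
  · obtain ⟨p, h1, h2, h3⟩ := (hU₀.and (Filter.Eventually.and hu (hnear u hu))).exists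
    obtain ⟨t, ht, hd⟩ := hbwd p h1 u h2
    exact ⟨t, ht, by linarith [dist_triangle (f (α t)) (η p u) (γ u)]⟩

end Limits

end FellowTraveller

theorem theorem1p5 {G X Y : Type*}
    [Group G] [MetricSpace X] [MetricSpace Y] [MulAction G X] [MulAction G Y]
    (hX : FellowTraveller.IsCAT0 X) (hY : FellowTraveller.IsCAT0 Y)
    (hGX : FellowTraveller.IsGeometricAction G X) (hGY : FellowTraveller.IsGeometricAction G Y)
    (hflats : FellowTraveller.HasIsolatedFlats X) (hrftp : FellowTraveller.HasRFTP X)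
    (f : X → Y) (hf : FellowTraveller.IsQuasiIsometry f)
    (hequiv : ∀ (g : G) (x : X), f (g • x) = g • f x) :
    ∃ L : ℝ≥0, ∀ (I : Set ℝ) (α : ℝ → X), FellowTraveller.IsGeodesic I α →
      ∃ (J : Set ℝ) (γ : ℝ → Y), FellowTraveller.IsGeodesic J γ ∧
        Metric.hausdorffEDist ((f ∘ α) '' I) (γ '' J) ≤ L := by
  obtain ⟨M, hM0, hM⟩ :=
    FellowTraveller.exists_segment_constant hX hY hGX hGY hflats hrftp hf hequiv
  have := hGY.properSpace hY
  set L : ℝ≥0 := ⟨M + 3, by positivity⟩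
  refine ⟨L, fun I α hα => ?_⟩
  obtain ⟨J, γ, hγ, h1, h2⟩ := FellowTraveller.exists_geodesic_of_segments hM hα
  have hle : ∀ x y : Y, dist x y ≤ M + 3 → edist x y ≤ (L : ℝ≥0∞) := by
    intro x y h
    rw [edist_dist, ← ENNReal.ofReal_coe_nnreal]
    exact ENNReal.ofReal_le_ofReal h
  refine ⟨J, γ, hγ, Metric.hausdorffEDist_le_of_mem_edist ?_ ?_⟩
  · rintro _ ⟨t, ht, rfl⟩
    obtain ⟨u, hu, hd⟩ := h1 t ht
    exact ⟨γ u, ⟨u, hu, rfl⟩, hle _ _ hd⟩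
  · rintro _ ⟨u, hu, rfl⟩
    obtain ⟨t, ht, hd⟩ := h2 u hu
    exact ⟨f (α t), ⟨t, ht, rfl⟩, by rw [edist_comm]; exact hle _ _ hd⟩
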